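/- \textbf{Setting.} Let $G\subset GL(r,\mathbb R)$ be a closed subgroup stable under transposition, with Cartan involution $\theta(g)=(g^{T})^{-1}$ (on the Lie algebra, $\theta X=-X^T$), $K=G^\theta$, $\mathfrak g=\mathrm{Lie}(G)$ and $\mathfrak s$ the symmetric matrices in $\mathfrak g$. Suppose $\mathfrak g$ contains $n$ commuting copies of $\mathfrak{sl}(2,\mathbb R)$ with standard bases $\{F_j,H_j,E_j\}$, where $F_j=-\theta(E_j)$, $H_j=[E_j,F_j]$, $E_j\neq 0$, $[H_j,E_j]=2E_j$ and $[H_j,F_j]=-2F_j$. Put $\mathfrak b=\sum_j\mathbb R H_j$ and $\epsilon_k(\sum_j h_jH_j)=h_k$, and suppose that the roots of $\mathfrak b$ in $\mathfrak g$ are exactly $\pm(\epsilon_j-\epsilon_k)$ $(j<k)$ and $\pm(\epsilon_j+\epsilon_k)$ $(j\le k)$. Let $\mathfrak n$ be the sum of the root spaces for $\epsilon_j+\epsilon_k$, $1\le j\le k\le n$. Suppose that each root $\epsilon_j+\epsilon_k$ $(j<k)$ has multiplicity $2d$ and each root $2\epsilon_j$ multiplicity $e+1$, with $d=0$ if $n=1$.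 Let $m=\dim\mathfrak n$. Let $\mathfrak a=\bigcap_{j<k}\ker(\epsilon_j-\epsilon_k)\subset\mathfrak b$, $A=\exp\mathfrak a$, $N_P=\exp\mathfrak n$, let $L$ be the centralizer of $\mathfrak a$ in $G$, let $M=\{\ell\in L:|\det(\mathrm{Ad}(\ell)|_{\mathfrak n})|=1\}$ (so that $L=MA$), and let $\mathfrak m$ be the Lie algebra of $M$. Let $\kappa(g)\in K$ denote the $K$-component of $g$ in the decomposition $G=K\exp(\mathfrak m\cap\mathfrak s)AN_P$. Let $\mathbf a=(a_1,\dots,a_n)$ be positive integers, and let $\mathbf b=(b_1,\dots,b_n)$ and $\mathbf c=(c_1,\dots,c_n)$ be non-negative real numbers. Let $1\le N\le n$, let $\mathbf p=(p_1,\dots,p_N)$ be integers with $1\le p_1<\dots<p_N\le n$, and let $\mathbf q=(q_1,\dots,q_n)$ with $q_j\in\{1,\dots,n\}$. For $\mathbf x\in(\mathbb R^+)^n$ put $\mathbf x_{\mathbf p}=(x_{p_1},\dots,x_{p_N})$ and $[\mathbf x_{\mathbf q}]=\kappa\big(\exp\sum_{j=1}^n x_{q_j}F_j\big)\in K$, and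 let $\varepsilon(y_1,\dots,y_N)=\mathrm{sign}\prod_{i<j}(y_i-y_j)$. If $d$ is not an integer, $\varepsilon^d$ is the principal power. \textbf{Proposition.} Let $\varphi\in C^\infty(K/K\cap M)$, that is, $\varphi:K\to\mathbb C$ is smooth and $\varphi(km)=\varphi(k)$ for $m\in K\cap M$. Then the integral $$\mathbf T_n(s\mathbf a+\mathbf b,\,t\mathbf a+\mathbf c,\,\mathbf p,\,\varphi[\mathbf x_{\mathbf q}])=\int_{(\mathbb R^+)^n}\prod_{j=1}^n\frac{x_j^{a_jt+c_j}}{(1+x_j^2)^{\frac12\left(a_js+b_j+\frac mn\right)}}\;\varepsilon(\mathbf x_{\mathbf p})^d\,\varphi[\mathbf x_{\mathbf q}]\;dx_n\cdots dx_1$$ converges absolutely and is complex analytic in $(s,t)$ on $$\mathcal D_0=\Big\{(s,t)\in\mathbb C^2:\ \max_j\frac{-1-c_j}{a_j}<\mathrm{Re}(t)<\mathrm{Re}(s)+\min_j\frac{b_j+\frac mn-1-c_j}{a_j}\Big\},$$ and it has a meromorphic continuation to all of $\mathbb C^2$: there is a meromorphic function on $\mathbb C^2$ (locally a quotient of two holomorphic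 functions, with denominator not identically zero) that equals $\mathbf T_n$ on $\mathcal D_0$. -/

import Mathlib

open MeasureTheory Filter Topology Matrix
open scoped ContDiff

noncomputable section

namespace RadialZeta

/-! ### Groups

Throughout, `G` is a closed transpose-stable subgroup of `GL(ι, ℝ)` and `E₁, …, Eₙ` are real
matrices; `θ(g) = (gᵀ)⁻¹` is the Cartan involution, with differential `X ↦ -Xᵀ`. -/

section Groups

variable {ι : Type*} [Fintype ι] [DecidableEq ι]

/-- The matrix exponential as an element of `GL(ι, ℝ)`. -/
def expGL (X : Matrix ι ι ℝ) : GL ι ℝ := (Matrix.isUnit_exp X).unit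

/-- The Cartan involution `θ(g) = (g⁻¹)ᵀ`. -/
def theta : GL ι ℝ →* GL ι ℝ where
  toFun g :=
    { val := ((g⁻¹ : GL ι ℝ) : Matrix ι ι ℝ)ᵀ
      inv := (g : Matrix ι ι ℝ)ᵀ
      val_inv := by rw [← Matrix.transpose_mul, ← Units.val_mul]; simp
      inv_val := by rw [← Matrix.transpose_mul, ← Units.val_mul]; simp }
  map_one' := by apply Units.ext; simp
  map_mul' g h := by
    apply Units.ext
    change (((g * h)⁻¹ : GL ι ℝ) : Matrix ι ι ℝ)ᵀ =
      ((g⁻¹ : GL ι ℝ) : Matrix ι ι ℝ)ᵀ * ((h⁻¹ : GL ι ℝ) : Matrix ι ι ℝ)ᵀ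
    rw [_root_.mul_inv_rev, Units.val_mul, Matrix.transpose_mul]

/-- `K`, the fixed point group of `θ` in `G`. -/
def maxCompact (G : Subgroup (GL ι ℝ)) : Subgroup (GL ι ℝ) :=
  G ⊓ theta.eqLocus (MonoidHom.id _)

/-- The Lie algebra `{X | exp(ℝX) ⊆ H}` of a subset `H` of `GL(ι, ℝ)` (for a closed subgroup). -/
def lieSet (H : Set (GL ι ℝ)) : Set (Matrix ι ι ℝ) :=
  {X | ∀ t : ℝ, expGL (t • X) ∈ H}

variable {n : ℕ}

/-- `F_j = -θ(E_j)`, the transpose of `E_j`. -/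
def F (E : Fin n → Matrix ι ι ℝ) (j : Fin n) : Matrix ι ι ℝ := (E j)ᵀ

/-- `H_j = [E_j, F_j]`. -/
def H (E : Fin n → Matrix ι ι ℝ) (j : Fin n) : Matrix ι ι ℝ := ⁅E j, F E j⁆

/-- The functional `ε_j` on `𝔟 = ∑ ℝ H_j`, as the vector of its values at `H_1, …, H_n`. -/
def eps (j : Fin n) : Fin n → ℝ := Pi.single j 1

/-- The space `{X ∈ 𝔤 | [H_k, X] = r_k X for all k}` of weight `r` for `𝔟` in `𝔤`. For a closed
subgroup `G` the set is already a linear subspace, and taking the span changes nothing. -/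
def rootSpace (G : Subgroup (GL ι ℝ)) (E : Fin n → Matrix ι ι ℝ) (r : Fin n → ℝ) :
    Submodule ℝ (Matrix ι ι ℝ) :=
  Submodule.span ℝ {X | X ∈ lieSet (G : Set (GL ι ℝ)) ∧ ∀ k, ⁅H E k, X⁆ = r k • X}

/-- `𝔫`, the sum of the root spaces for the roots `ε_j + ε_k`, `1 ≤ j, k ≤ n`. -/
def nilrad (G : Subgroup (GL ι ℝ)) (E : Fin n → Matrix ι ι ℝ) : Submodule ℝ (Matrix ι ι ℝ) :=
  ⨆ j : Fin n, ⨆ k : Fin n, rootSpace G E (eps j + eps k)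

/-- `m = dim 𝔫`. -/
def nilDim (G : Subgroup (GL ι ℝ)) (E : Fin n → Matrix ι ι ℝ) : ℕ := Module.finrank ℝ (nilrad G E)

/-- `N = exp 𝔫`. -/
def groupN (G : Subgroup (GL ι ℝ)) (E : Fin n → Matrix ι ι ℝ) : Set (GL ι ℝ) :=
  {g | ∃ Y ∈ nilrad G E, g = expGL Y}

/-- `𝔞`, the intersection of the kernels of the `ε_j - ε_k` in `𝔟`. -/
def lieA (E : Fin n → Matrix ι ι ℝ) : Set (Matrix ι ι ℝ) :=
  {X | ∃ h : Fin n → ℝ, (∀ j k, h j = h k) ∧ X = ∑ j, h j • H E j}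

/-- `A = exp 𝔞`. -/
def groupA (E : Fin n → Matrix ι ι ℝ) : Set (GL ι ℝ) :=
  {g | ∃ X ∈ lieA E, g = expGL X}

/-- The Levi factor `L`, the centralizer of `𝔞` in `G`. -/
def groupL (G : Subgroup (GL ι ℝ)) (E : Fin n → Matrix ι ι ℝ) : Set (GL ι ℝ) :=
  {g | g ∈ G ∧ ∀ X ∈ lieA E, (g : Matrix ι ι ℝ) * X = X * (g : Matrix ι ι ℝ)}

/-- The factor `M` of `L = MA`: the elements of `L` whose adjoint action on `𝔫` has
determinant `±1`. -/
def groupM (G : Subgroup (GL ι ℝ)) (E : Fin n → Matrix ι ι ℝ) : Set (GL ι ℝ) :=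
  {g | g ∈ groupL G E ∧ ∃ T : nilrad G E →ₗ[ℝ] nilrad G E,
    (∀ Y, (T Y : Matrix ι ι ℝ) = (g : Matrix ι ι ℝ) * Y * ((g⁻¹ : GL ι ℝ) : Matrix ι ι ℝ)) ∧
    |LinearMap.det T| = 1}

/-- `𝔪 ∩ 𝔰`: the symmetric matrices in the Lie algebra of `M`. -/
def lieMS (G : Subgroup (GL ι ℝ)) (E : Fin n → Matrix ι ι ℝ) : Set (Matrix ι ι ℝ) :=
  {S | S ∈ lieSet (groupM G E) ∧ Sᵀ = S}

/-- `k` is the `K`-component of `g` for the decomposition `K exp(𝔪 ∩ 𝔰) A N`. -/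
def IsKPart (G : Subgroup (GL ι ℝ)) (E : Fin n → Matrix ι ι ℝ) (g : GL ι ℝ)
    (k : maxCompact G) : Prop :=
  ∃ S ∈ lieMS G E, ∃ a ∈ groupA E, ∃ y ∈ groupN G E, g = (k : GL ι ℝ) * expGL S * a * y

open Classical in
/-- The Iwasawa projection `κ` to `K` (with value `1` where there is no decomposition). -/
def kappa (G : Subgroup (GL ι ℝ)) (E : Fin n → Matrix ι ι ℝ) (g : GL ι ℝ) : maxCompact G :=
  if h : ∃ k, IsKPart G E g k then h.choose else 1

/-- The groups `G` under consideration: closed transpose-stable linear groups (so that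
`g ↦ (gᵀ)⁻¹` is a Cartan involution) with commuting copies of `𝔰𝔩(2, ℝ)` spanned by
`F_j, H_j, E_j`, such that the roots of `𝔟 = ∑ ℝ H_j` in `𝔤` are `±(ε_j - ε_k)` (`j ≠ k`) and
`±(ε_j + ε_k)`, short roots in `𝔫` have multiplicity `2d` and long ones multiplicity `e + 1`. -/
structure IsAdmissible (G : Subgroup (GL ι ℝ)) (E : Fin n → Matrix ι ι ℝ) (d : ℝ) (e : ℕ) :
    Prop where
  isClosed : IsClosed (G : Set (GL ι ℝ))
  theta_mem : ∀ g ∈ G, theta g ∈ G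
  E_mem : ∀ j, E j ∈ lieSet (G : Set (GL ι ℝ))
  E_ne_zero : ∀ j, E j ≠ 0
  H_E : ∀ j, ⁅H E j, E j⁆ = (2 : ℝ) • E j
  H_F : ∀ j, ⁅H E j, F E j⁆ = (-2 : ℝ) • F E j
  E_comm_E : ∀ j k, j ≠ k → ⁅E j, E k⁆ = 0
  E_comm_F : ∀ j k, j ≠ k → ⁅E j, F E k⁆ = 0
  roots : ∀ r : Fin n → ℝ, r ≠ 0 →
    (rootSpace G E r ≠ ⊥ ↔
      (∃ j k, j ≠ k ∧ r = eps j - eps k) ∨ ∃ j k, r = eps j + eps k ∨ r = -(eps j + eps k))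
  short_mult : ∀ j k, j ≠ k →
    (Module.finrank ℝ (rootSpace G E (eps j + eps k)) : ℝ) = 2 * d
  long_mult : ∀ j, Module.finrank ℝ (rootSpace G E (eps j + eps j)) = e + 1
  d_eq_zero : n = 1 → d = 0

/-- `φ ∈ C^∞(K / K ∩ M)`: `φ` is a smooth function on `K`, invariant on the right under `K ∩ M`.
As `K` is a compact submanifold of the space of matrices, the smooth functions on `K` are the
restrictions of smooth functions on that space. -/
def IsSmoothRightInvariant (G : Subgroup (GL ι ℝ)) (E : Fin n → Matrix ι ι ℝ)
    (φ : maxCompact G → ℂ) : Prop :=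
  (∃ Φ : (ι → ι → ℝ) → ℂ, ContDiff ℝ ∞ Φ ∧
    ∀ k : maxCompact G, φ k = Φ (fun i j => ((k : GL ι ℝ) : Matrix ι ι ℝ) i j)) ∧
  ∀ k m : maxCompact G, (m : GL ι ℝ) ∈ groupM G E → φ (k * m) = φ k

/-- `[x_q] = κ(exp(∑ x_{q_j} F_j))`. -/
def kappaAt (G : Subgroup (GL ι ℝ)) (E : Fin n → Matrix ι ι ℝ) (q : Fin n → Fin n)
    (x : Fin n → ℝ) : maxCompact G :=
  kappa G E (expGL (∑ j, x (q j) • F E j))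

/-! ### The radial integrals -/

/-- The sign `ε(x_1, …, x_N)` of `∏_{i < j} (x_i - x_j)`. -/
def signProd {N : ℕ} (x : Fin N → ℝ) : ℝ :=
  Real.sign (∏ i : Fin N, ∏ j ∈ Finset.Ioi i, (x i - x j))

/-- The integrand of `T_n(s, t, p, φ[x_q])`. The power `ε^d` is the principal complex power, which
for an integer `d` is the usual one. -/
def integrand (G : Subgroup (GL ι ℝ)) (E : Fin n → Matrix ι ι ℝ) (d : ℝ) (s t : Fin n → ℂ)
    {N : ℕ} (p : Fin N → Fin n) (φ : maxCompact G → ℂ) (q : Fin n → Fin n)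
    (x : Fin n → ℝ) : ℂ :=
  (∏ j, (x j : ℂ) ^ t j /
    ((1 + x j ^ 2 : ℝ) : ℂ) ^ ((s j + (nilDim G E : ℂ) / (n : ℂ)) / 2)) *
  ((signProd (fun i => x (p i)) : ℝ) : ℂ) ^ (d : ℂ) * φ (kappaAt G E q x)

/-- The orthant `(ℝ⁺)ⁿ`. -/
def orthant (n : ℕ) : Set (Fin n → ℝ) := {x | ∀ j, 0 < x j}

/-- `T_n(s, t, p, φ[x_q])` for vectors `s, t ∈ ℂⁿ`. -/
def radialT (G : Subgroup (GL ι ℝ)) (E : Fin n → Matrix ι ι ℝ) (d : ℝ) (s t : Fin n → ℂ)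
    {N : ℕ} (p : Fin N → Fin n) (φ : maxCompact G → ℂ) (q : Fin n → Fin n) : ℂ :=
  ∫ x in orthant n, integrand G E d s t p φ q x

end Groups

/-- The domain `𝒟₀`, with `μ` in the place of `m / n`. -/
def domainD {n : ℕ} (μ : ℝ) (a : Fin n → ℕ) (b c : Fin n → ℝ) : Set (ℂ × ℂ) :=
  {z | (⨆ j, (-1 - c j) / (a j : ℝ)) < z.2.re ∧
    z.2.re < z.1.re + ⨅ j, (b j + μ - 1 - c j) / (a j : ℝ)}

/-- `f` is meromorphic on all of `V`: near every point it is a quotient `g / h` of analytic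
functions, where `h` does not vanish identically (the values of `f` on the zeros of `h` are
irrelevant). -/
def IsMeromorphic {V : Type*} [NormedAddCommGroup V] [NormedSpace ℂ V] (f : V → ℂ) : Prop :=
  ∀ z₀ : V, ∃ g h : V → ℂ, AnalyticAt ℂ g z₀ ∧ AnalyticAt ℂ h z₀ ∧
    (∃ᶠ z in 𝓝 z₀, h z ≠ 0) ∧ ∀ᶠ z in 𝓝 z₀, h z ≠ 0 → f z = g z / h z

end RadialZeta

end

noncomputable section

namespace RadialZeta

/-! Write `x = exp y`. Up to a null set, `y`-space is the disjoint union of `2ⁿ n!` cones, on each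
of which the signs of the `y_i` and the order of the `|y_i|` are fixed. Each cone is the image of an
orthant under a unimodular linear map in which `|y_i|` is a partial sum of the `w_k`. With `v =
exp(-w)`, every `x_i` is `u_i` or `1/u_i`, where `u_i` is a product of some of the `v_k`. Jacobian
and weight together become a monomial in `v`, with exponents affine in `(s, t)`, times powers of `1
+ u_i²`, which are smooth on the whole cube `0 ≤ v ≤ 1`. The sign `ε(x_p)` is constant on each cone
(`integral_orthant_eq_sum`, `radialWeight_chart`, `chart_lt_iff`).

The factor `φ[x_q]` is smooth in `v` as well, and this is the group-theoretic part. The Iwasawa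
decomposition in each commuting copy of `sl(2)` gives `exp(∑ y_j F_j)` the `K`-component `exp(∑
arctan(y_j) (F_j - E_j))` (`exp_smul_F_eq`, `isKPart_rotation`). The component is unique up to `K ∩
M` (`inv_mul_mem_groupM`), which `φ` does not see. Finally `arctan x_i` is either `arctan u_i` or
`π/2 - arctan u_i`.

What remains are Laplace integrals of `exp(-∑ (M_j z + c_j) w_j)` against a smooth function of
`exp(-w)`. They converge and are analytic where all `Re(M_j z + c_j)` are positive
(`analyticAt_laplaceInt`). Integration by parts in `w_i` (`laplaceInt_eq`) writes `M_i z + c_i`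
times the integral through integrals with `c_i` raised by one and a boundary term on the face `w_i =
0`, where `c_i` plays no role. Iteration pushes the domain as far left as desired at the price of
affine denominators (`hasContinuation_laplaceInt`), and the identity theorem glues the results
(`exists_isMeromorphic`). -/

/-- Expanding the exponential and integrating term by term gives a power series in `h`. The
exponential moment in `hint` is exactly what makes the series converge on the ball of radius `r`. -/
theorem analyticAt_integral_exp {Ω V : Type*} [MeasurableSpace Ω] {μ : Measure Ω}
    [NormedAddCommGroup V] [NormedSpace ℂ V] {g : Ω → ℂ} {L : Ω → V →L[ℂ] ℂ} {r : ℝ}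
    (hg : AEStronglyMeasurable g μ) (hL : AEStronglyMeasurable L μ) (hr : 0 < r)
    (hint : Integrable (fun w => ‖g w‖ * Real.exp (r * ‖L w‖)) μ) :
    AnalyticAt ℂ (fun h => ∫ w, g w * Complex.exp (L w h) ∂μ) 0 := by
  let P : (k : ℕ) → (V →L[ℂ] ℂ) → ContinuousMultilinearMap ℂ (fun _ : Fin k => V) ℂ :=
    fun k l => (ContinuousMultilinearMap.mkPiAlgebraFin ℂ k ℂ).compContinuousLinearMap fun _ => l
  have hPc (k : ℕ) : Continuous (P k) := by
    have h1 := (ContinuousMultilinearMap.compContinuousLinearMapContinuousMultilinear ℂ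
      (fun _ : Fin k => V) (fun _ : Fin k => ℂ) ℂ).cont
    have h2 : Continuous fun l : V →L[ℂ] ℂ => (fun _ : Fin k => l) := by fun_prop
    have h3 := h1.comp h2
    exact (ContinuousLinearMap.apply ℂ _
      (ContinuousMultilinearMap.mkPiAlgebraFin ℂ k ℂ)).continuous.comp h3
  have hPn (k : ℕ) (l : V →L[ℂ] ℂ) : ‖P k l‖ ≤ ‖l‖ ^ k := by
    refine (ContinuousMultilinearMap.norm_compContinuousLinearMap_le _ _).trans ?_
    simp
  have hPa (k : ℕ) (l : V →L[ℂ] ℂ) (h : V) : P k l (fun _ => h) = l h ^ k := by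
    simp [P, List.ofFn_const, List.prod_replicate]
  -- The `k`-th Taylor coefficient of `g w * exp (L w h)` at `h = 0`, as a multilinear map.
  let φ : (k : ℕ) → Ω → ContinuousMultilinearMap ℂ (fun _ : Fin k => V) ℂ :=
    fun k w => (g w * (k.factorial : ℂ)⁻¹) • P k (L w)
  have hφn (k : ℕ) (w : Ω) : ‖φ k w‖ ≤ ‖g w‖ * (‖L w‖ ^ k / k.factorial) := by
    simp only [φ, norm_smul, norm_mul, norm_inv, Complex.norm_natCast]
    rw [mul_assoc, div_eq_inv_mul]
    gcongr
    exact hPn k _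
  have hmeasφ (k : ℕ) : AEStronglyMeasurable (φ k) μ :=
    ((hg.mul_const _)).smul ((hPc k).comp_aestronglyMeasurable hL)
  have hb (k : ℕ) (w : Ω) :
      ‖g w‖ * (‖L w‖ ^ k / k.factorial) * r ^ k ≤ ‖g w‖ * Real.exp (r * ‖L w‖) := by
    rw [mul_assoc]
    gcongr
    refine le_trans (le_of_eq ?_) (Real.pow_div_factorial_le_exp (r * ‖L w‖) (by positivity) k)
    rw [mul_pow]; ring
  have hJ (k : ℕ) : Integrable (fun w => ‖g w‖ * (‖L w‖ ^ k / k.factorial)) μ := by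
    have : Integrable (fun w => ‖g w‖ * (‖L w‖ ^ k / k.factorial) * r ^ k) μ := by
      refine hint.mono' ?_ (.of_forall fun w => ?_)
      · exact (hg.norm.mul ((hL.norm.pow k).mul_const _)).mul_const _
      · rw [Real.norm_of_nonneg (by positivity)]
        exact hb k w
    have h2 := this.mul_const ((r ^ k)⁻¹)
    refine h2.congr (.of_forall fun w => ?_)
    field_simp
  have hI (k : ℕ) : Integrable (φ k) μ := (hJ k).mono' (hmeasφ k) (.of_forall (hφn k))
  have hsum : Summable fun k : ℕ => (∫ w, ‖g w‖ * (‖L w‖ ^ k / k.factorial) ∂μ) * r ^ k := by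
    -- Partial sums of the exponential series of `r * ‖L w‖` stay below the exponential, so the
    -- integral in `hint` bounds all partial sums.
    refine summable_of_sum_range_le (c := ∫ w, ‖g w‖ * Real.exp (r * ‖L w‖) ∂μ) (fun k => ?_) ?_
    · exact mul_nonneg (integral_nonneg fun w => by positivity) (by positivity)
    · intro m
      simp_rw [← integral_mul_const]
      rw [← integral_finsetSum _ fun k _ => (hJ k).mul_const _]
      refine integral_mono (integrable_finsetSum _ fun k _ => (hJ k).mul_const _) hint ?_
      intro w
      simp only [mul_assoc]
      rw [← Finset.mul_sum]
      gcongr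
      refine le_trans (le_of_eq ?_) (Real.sum_le_exp_of_nonneg (x := r * ‖L w‖) (by positivity) m)
      refine Finset.sum_congr rfl fun k _ => ?_
      rw [mul_pow]; ring
  let p : FormalMultilinearSeries ℂ V ℂ := fun k => ∫ w, φ k w ∂μ
  have hp (k : ℕ) : ‖p k‖ ≤ ∫ w, ‖g w‖ * (‖L w‖ ^ k / k.factorial) ∂μ :=
    norm_integral_le_of_norm_le (hJ k) (.of_forall (hφn k))
  refine ⟨p, ENNReal.ofReal r, ?_, by simpa using hr, ?_⟩
  · refine p.le_radius_of_summable_norm (r := r.toNNReal) ?_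
    rw [Real.coe_toNNReal _ hr.le]
    refine hsum.of_nonneg_of_le (fun k => by positivity) fun k => ?_
    gcongr
    exact hp k
  · intro y hy
    have hy' : ‖y‖ < r := by
      rw [Metric.eball_ofReal] at hy
      simpa using hy
    have hle (k : ℕ) (w : Ω) : ‖φ k w fun _ => y‖ ≤ ‖g w‖ * (‖L w‖ ^ k / k.factorial) * r ^ k := by
      refine ((φ k w).le_opNorm _).trans ?_
      simp only [Finset.prod_const, Finset.card_univ, Fintype.card_fin]
      gcongr
      exact hφn k w
    have hF (k : ℕ) : Integrable (fun w => φ k w fun _ => y) μ :=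
      (ContinuousMultilinearMap.apply ℂ _ _ (fun _ => y)).integrable_comp (hI k)
    have hmain := hasSum_integral_of_summable_integral_norm (F := fun k w => φ k w fun _ => y) hF
      (by
        refine hsum.of_nonneg_of_le (fun k => integral_nonneg fun _ => norm_nonneg _) fun k => ?_
        rw [← integral_mul_const]
        exact integral_mono (hF k).norm ((hJ k).mul_const _) (hle k))
    convert! hmain using 1
    · ext k
      exact ContinuousMultilinearMap.integral_apply (hI k) _
    · refine integral_congr_ae (.of_forall fun w => ?_)
      simp only [zero_add]
      have h1 := (NormedSpace.expSeries_div_hasSum_exp (L w y)).mul_left (g w)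
      rw [← Complex.exp_eq_exp_ℂ] at h1
      rw [← h1.tsum_eq]
      refine tsum_congr fun k => ?_
      simp only [φ, _root_.smul_apply, hPa, smul_eq_mul]
      ring

/-! ### Lebesgue measure on the faces of the orthant -/

variable {n : ℕ}

/-- The measure on the `j`-th axis: Lebesgue measure on `(0, ∞)` if `j ∈ S`, the point mass at `0`
otherwise. -/
def axisMeasure (S : Finset (Fin n)) (j : Fin n) : Measure ℝ :=
  if j ∈ S then volume.restrict (Set.Ioi 0) else Measure.dirac 0

instance (S : Finset (Fin n)) (j : Fin n) : SigmaFinite (axisMeasure S j) := by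
  unfold axisMeasure
  split_ifs <;> infer_instance

/-- Lebesgue measure on the face of the orthant spanned by the coordinates in `S`. -/
def faceMeasure (S : Finset (Fin n)) : Measure (Fin n → ℝ) := Measure.pi (axisMeasure S)

theorem faceMeasure_univ :
    faceMeasure (Finset.univ : Finset (Fin n)) = volume.restrict {w | ∀ j, 0 < w j} := by
  have : {w : Fin n → ℝ | ∀ j, 0 < w j} = Set.univ.pi fun _ => Set.Ioi 0 := by
    ext w; simp
  rw [this, volume_pi, Measure.restrict_pi_pi]
  unfold faceMeasure
  congr
  ext1 j
  simp [axisMeasure]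

theorem ae_nonneg_faceMeasure (S : Finset (Fin n)) :
    ∀ᵐ w ∂faceMeasure S, ∀ j, 0 ≤ w j := by
  refine ae_all_iff.2 fun j => ?_
  have : ∀ᵐ t ∂axisMeasure S j, 0 ≤ t := by
    unfold axisMeasure
    split_ifs
    · exact (ae_restrict_mem measurableSet_Ioi).mono fun t ht => le_of_lt ht
    · rw [ae_dirac_iff measurableSet_Ici]
  exact (Measure.tendsto_eval_ae_ae (μ := axisMeasure S) (i := j)).eventually this

theorem integrable_exp_neg_faceMeasure (S : Finset (Fin n)) {δ : Fin n → ℝ} (hδ : ∀ j, 0 < δ j) :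
    Integrable (fun w => Real.exp (-∑ j, δ j * w j)) (faceMeasure S) := by
  have h (j : Fin n) : Integrable (fun t : ℝ => Real.exp (-δ j * t)) (axisMeasure S j) := by
    unfold axisMeasure
    split_ifs
    · exact exp_neg_integrableOn_Ioi 0 (hδ j)
    · exact integrable_dirac (by simp)
  refine (Integrable.fintype_prod h).congr (.of_forall fun w => ?_)
  simp only
  rw [← Real.exp_sum, ← Finset.sum_neg_distrib]
  simp

/-- Integration by parts in one variable on a face of the orthant. -/
theorem integral_deriv_faceMeasure {S : Finset (Fin n)} {i : Fin n} (hi : i ∈ S)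
    {f f' : (Fin n → ℝ) → ℂ} (hf' : Integrable f' (faceMeasure S))
    (hf : Integrable f (faceMeasure (S.erase i)))
    (hderiv : ∀ w : Fin n → ℝ, HasDerivAt (fun t => f (Function.update w i t)) (f' w) (w i))
    (hlim : ∀ w, Tendsto (fun t => f (Function.update w i t)) atTop (𝓝 0)) :
    ∫ w, f' w ∂faceMeasure S = -∫ w, f w ∂faceMeasure (S.erase i) := by
  obtain _ | m := n
  · exact i.elim0
  have hrest (j : Fin m) : axisMeasure (S.erase i) (i.succAbove j) =
      axisMeasure S (i.succAbove j) := by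
    simp [axisMeasure, Fin.succAbove_ne]
  have hS : axisMeasure S i = volume.restrict (Set.Ioi 0) := by simp [axisMeasure, hi]
  have hSe : axisMeasure (S.erase i) i = Measure.dirac 0 := by simp [axisMeasure]
  have mp1 := (measurePreserving_piFinSuccAbove (axisMeasure S) i).symm
  have mp2 := (measurePreserving_piFinSuccAbove (axisMeasure (S.erase i)) i).symm
  simp only [hrest, hSe] at mp2
  rw [hS] at mp1
  have i1 := (mp1.integrable_comp_emb (MeasurableEquiv.measurableEmbedding _)).2 hf'
  have i2 := (mp2.integrable_comp_emb (MeasurableEquiv.measurableEmbedding _)).2 hf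
  simp only [Function.comp_def] at i1 i2
  unfold faceMeasure
  rw [← mp1.integral_comp', ← mp2.integral_comp', integral_prod_symm _ i1,
    integral_prod_symm _ i2, ← integral_neg]
  refine integral_congr_ae ?_
  filter_upwards [i1.prod_left_ae] with w hw
  simp only [integral_dirac, MeasurableEquiv.piFinSuccAbove_symm_apply] at hw ⊢
  have hu (s t : ℝ) : Function.update (i.insertNth (α := fun _ => ℝ) s w) i t = i.insertNth t w := by
    ext j
    refine Fin.succAboveCases i ?_ (fun j => ?_) j <;> simp [Fin.succAbove_ne]
  -- The fundamental theorem of calculus on `(0, ∞)`: the limit at infinity is `0`, and the value at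
  -- `0` is what the Dirac axis of the smaller face picks out.
  rw [integral_Ioi_of_hasDerivAt_of_tendsto' (f := fun t => f (i.insertNth t w)) (m := 0)]
  · rw [zero_sub]
    rfl
  · intro x _
    have := hderiv (i.insertNth x w)
    simp only [hu, Fin.insertNth_apply_same] at this
    exact this
  · exact hw
  · simpa [hu] using hlim (i.insertNth 0 w)

/-- The point `(e^{-w_1}, …, e^{-w_n})`. -/
def expNeg {n : ℕ} (w : Fin n → ℝ) : Fin n → ℝ := fun j => Real.exp (-w j)

/-- The partial derivative in the `i`-th variable. -/
def partialDeriv {n : ℕ} (i : Fin n) (ψ : (Fin n → ℝ) → ℂ) (v : Fin n → ℝ) : ℂ :=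
  fderiv ℝ ψ v (Pi.single i 1)

/-! ### Laplace integrals: convergence and analyticity -/

section Laplace

variable {V : Type*} [NormedAddCommGroup V] [NormedSpace ℂ V] {n : ℕ} {κ : Type*} [Fintype κ]
  (M : Fin n → V →L[ℂ] ℂ) (Q : κ → V →L[ℂ] ℂ) (l : κ → (Fin n → ℝ) → ℂ)

/-- The integrand of the Laplace integrals: in the coordinates `v = e^{-w}` it is
`∏ v_j ^ (M_j z + c_j)` times the smooth function `exp (∑ Q_k(z) l_k(v)) ψ(v)`. -/
def laplaceKernel (c : Fin n → ℂ) (ψ : (Fin n → ℝ) → ℂ) (z : V) (w : Fin n → ℝ) : ℂ :=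
  Complex.exp (-∑ j, (M j z + c j) * w j + ∑ k, Q k z * l k (expNeg w)) * ψ (expNeg w)

/-- The Laplace integral over a face of the orthant. -/
def laplaceInt (S : Finset (Fin n)) (c : Fin n → ℂ) (ψ : (Fin n → ℝ) → ℂ) (z : V) : ℂ :=
  ∫ w, laplaceKernel M Q l c ψ z w ∂faceMeasure S

/-- The set where `Re (M_j z + c_j) > -r_j` for all `j`. -/
def laplaceDomain (c : Fin n → ℂ) (r : Fin n → ℕ) : Set V :=
  {z | ∀ j, -(r j : ℝ) < (M j z + c j).re}

theorem expNeg_mem_Icc {w : Fin n → ℝ} (hw : ∀ j, 0 ≤ w j) : expNeg w ∈ Set.Icc (0 : Fin n → ℝ) 1 :=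
  ⟨fun j => (Real.exp_pos _).le, fun j => by simpa [expNeg] using hw j⟩

theorem continuous_expNeg : Continuous (expNeg : (Fin n → ℝ) → Fin n → ℝ) := by
  unfold expNeg
  fun_prop

theorem exists_bound_expNeg {f : (Fin n → ℝ) → ℂ} (hf : Continuous f) :
    ∃ C, 0 ≤ C ∧ ∀ w : Fin n → ℝ, (∀ j, 0 ≤ w j) → ‖f (expNeg w)‖ ≤ C := by
  obtain ⟨C, hC⟩ := (isCompact_Icc (a := (0 : Fin n → ℝ)) (b := 1)).exists_bound_of_continuousOn
    hf.continuousOn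
  exact ⟨max C 0, le_max_right _ _, fun w hw => (hC _ (expNeg_mem_Icc hw)).trans (le_max_left _ _)⟩

variable {l} in
theorem exists_bound_laplaceKernel (hl : ∀ k, Continuous (l k)) (c : Fin n → ℂ)
    {ψ : (Fin n → ℝ) → ℂ} (hψ : Continuous ψ) (z : V) :
    ∃ C, 0 ≤ C ∧ ∀ w : Fin n → ℝ, (∀ j, 0 ≤ w j) →
      ‖laplaceKernel M Q l c ψ z w‖ ≤ C * Real.exp (-∑ j, (M j z + c j).re * w j) := by
  obtain ⟨C, hC0, hC⟩ := exists_bound_expNeg (n := n)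
    (f := fun v => Complex.exp (∑ k, Q k z * l k v) * ψ v) (by fun_prop)
  refine ⟨C, hC0, fun w hw => ?_⟩
  have := hC w hw
  rw [laplaceKernel, Complex.exp_add, mul_assoc, norm_mul, mul_comm]
  gcongr
  rw [Complex.norm_exp]
  simp

variable {l} in
theorem continuous_laplaceKernel (hl : ∀ k, Continuous (l k)) (c : Fin n → ℂ)
    {ψ : (Fin n → ℝ) → ℂ} (hψ : Continuous ψ) (z : V) :
    Continuous (laplaceKernel M Q l c ψ z) := by
  have := continuous_expNeg (n := n)
  unfold laplaceKernel
  fun_prop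

variable {l} in
theorem integrable_laplaceKernel (S : Finset (Fin n)) (hl : ∀ k, Continuous (l k)) {c : Fin n → ℂ}
    {ψ : (Fin n → ℝ) → ℂ} (hψ : Continuous ψ) {z : V} (hz : z ∈ laplaceDomain M c 0) :
    Integrable (laplaceKernel M Q l c ψ z) (faceMeasure S) := by
  obtain ⟨C, -, hC⟩ := exists_bound_laplaceKernel M Q hl c hψ z
  have h := integrable_exp_neg_faceMeasure S (δ := fun j => (M j z + c j).re) fun j => by
    simpa using hz j
  refine (h.const_mul C).mono' (continuous_laplaceKernel M Q hl c hψ z).aestronglyMeasurable ?_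
  filter_upwards [ae_nonneg_faceMeasure S] with w hw
  exact hC w hw

variable {l} in
-- The kernel at `y` is the kernel at `z` times `exp (L w (y - z))`, where `‖L w‖` grows at most
-- linearly in `w`. The exponential decay of the kernel at `z` therefore supplies the moment needed
-- in `analyticAt_integral_exp`.
theorem analyticAt_laplaceInt (S : Finset (Fin n)) (hl : ∀ k, Continuous (l k)) {c : Fin n → ℂ}
    {ψ : (Fin n → ℝ) → ℂ} (hψ : Continuous ψ) {z : V} (hz : z ∈ laplaceDomain M c 0) :
    AnalyticAt ℂ (laplaceInt M Q l S c ψ) z := by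
  have hce := continuous_expNeg (n := n)
  have hz' (j : Fin n) : 0 < (M j z + c j).re := by simpa using hz j
  let L : (Fin n → ℝ) → V →L[ℂ] ℂ := fun w =>
    -∑ j, (w j : ℂ) • M j + ∑ k, l k (expNeg w) • Q k
  have hL : Continuous L := by fun_prop
  -- The radius is so small that the perturbation uses at most half of each decay rate. The other
  -- half keeps the integral finite.
  obtain ⟨r, hr, hrM⟩ : ∃ r : ℝ, 0 < r ∧ ∀ j, r * ‖M j‖ < (M j z + c j).re / 2 := by
    have h1 : ∀ᶠ r : ℝ in 𝓝[>] 0, ∀ j, r * ‖M j‖ < (M j z + c j).re / 2 := by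
      refine eventually_all.2 fun j => ?_
      have : Tendsto (fun r : ℝ => r * ‖M j‖) (𝓝[>] 0) (𝓝 (0 * ‖M j‖)) :=
        ((continuous_id.mul continuous_const).tendsto 0).mono_left nhdsWithin_le_nhds
      refine this.eventually_lt_const ?_
      rw [zero_mul]
      exact half_pos (hz' j)
    obtain ⟨r, h2, h3⟩ := (h1.and self_mem_nhdsWithin).exists
    exact ⟨r, h3, h2⟩
  obtain ⟨C, hC0, hC⟩ := exists_bound_laplaceKernel M Q hl c hψ z
  choose B hB0 hB using fun k => exists_bound_expNeg (hl k)
  have hint : Integrable (fun w => ‖laplaceKernel M Q l c ψ z w‖ * Real.exp (r * ‖L w‖))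
      (faceMeasure S) := by
    have h := integrable_exp_neg_faceMeasure S (δ := fun j => (M j z + c j).re / 2) fun j =>
      half_pos (hz' j)
    refine (h.const_mul (C * Real.exp (r * ∑ k, B k * ‖Q k‖))).mono' ?_ ?_
    · have := continuous_laplaceKernel M Q hl c hψ z
      exact Continuous.aestronglyMeasurable (by fun_prop)
    filter_upwards [ae_nonneg_faceMeasure S] with w hw
    have hLw : ‖L w‖ ≤ ∑ j, w j * ‖M j‖ + ∑ k, B k * ‖Q k‖ := by
      refine (norm_add_le _ _).trans (add_le_add ?_ ?_)
      · rw [norm_neg]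
        refine (norm_sum_le _ _).trans (Finset.sum_le_sum fun j _ => ?_)
        rw [norm_smul, Complex.norm_real, Real.norm_of_nonneg (hw j)]
      · refine (norm_sum_le _ _).trans (Finset.sum_le_sum fun k _ => ?_)
        rw [norm_smul]
        gcongr
        exact hB k w hw
    have h5 : r * ∑ j, w j * ‖M j‖ ≤ ∑ j, (M j z + c j).re / 2 * w j := by
      rw [Finset.mul_sum]
      refine Finset.sum_le_sum fun j _ => ?_
      nlinarith [hrM j, hw j]
    have h6 : ∑ j, (M j z + c j).re * w j = ∑ j, (M j z + c j).re / 2 * w j +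
        ∑ j, (M j z + c j).re / 2 * w j := by
      rw [← Finset.sum_add_distrib]
      exact Finset.sum_congr rfl fun j _ => by ring
    rw [Real.norm_of_nonneg (by positivity)]
    calc _ ≤ C * Real.exp (-∑ j, (M j z + c j).re * w j) *
          Real.exp (r * (∑ j, w j * ‖M j‖ + ∑ k, B k * ‖Q k‖)) := by
          gcongr
          exact hC w hw
      _ = C * Real.exp (-∑ j, (M j z + c j).re * w j +
          r * (∑ j, w j * ‖M j‖ + ∑ k, B k * ‖Q k‖)) := by rw [mul_assoc, ← Real.exp_add]
      _ ≤ C * Real.exp (r * (∑ k, B k * ‖Q k‖) + -∑ j, (M j z + c j).re / 2 * w j) := by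
          refine mul_le_mul_of_nonneg_left (Real.exp_le_exp.2 ?_) hC0
          rw [h6, mul_add]
          linarith
      _ = _ := by rw [Real.exp_add, mul_assoc]
  have key := analyticAt_integral_exp
    (continuous_laplaceKernel M Q hl c hψ z).aestronglyMeasurable hL.aestronglyMeasurable hr hint
  have hcomp : laplaceInt M Q l S c ψ = (fun h => ∫ w, laplaceKernel M Q l c ψ z w *
      Complex.exp (L w h) ∂faceMeasure S) ∘ fun y => y - z := by
    ext y
    refine integral_congr_ae (.of_forall fun w => ?_)
    simp only [laplaceKernel]
    rw [mul_right_comm, ← Complex.exp_add]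
    congr 2
    simp only [L, _root_.add_apply, _root_.neg_apply, _root_.sum_apply, _root_.smul_apply,
      map_sub, smul_eq_mul, add_mul, Finset.sum_add_distrib]
    simp only [mul_comm (w _ : ℂ), mul_comm (l _ _)]
    ring
  rw [hcomp]
  refine AnalyticAt.comp (by simpa using key) ?_
  exact analyticAt_id.sub analyticAt_const

end Laplace

theorem ContDiff.partialDeriv {n : ℕ} {ψ : (Fin n → ℝ) → ℂ} (hψ : ContDiff ℝ ∞ ψ) (i : Fin n) :
    ContDiff ℝ ∞ (partialDeriv i ψ) :=
  (hψ.fderiv_right (m := ∞) (by simp)).clm_apply contDiff_const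

theorem hasDerivAt_comp_expNeg {n : ℕ} {ψ : (Fin n → ℝ) → ℂ} (hψ : Differentiable ℝ ψ) (i : Fin n)
    (w : Fin n → ℝ) :
    HasDerivAt (fun t => ψ (expNeg (Function.update w i t)))
      (-(Real.exp (-w i) * partialDeriv i ψ (expNeg w))) (w i) := by
  have h1 : HasDerivAt (fun t => expNeg (Function.update w i t))
      (-Real.exp (-w i) • (Pi.single i 1 : Fin n → ℝ)) (w i) := by
    refine hasDerivAt_pi.2 fun j => ?_
    rcases eq_or_ne j i with rfl | hj
    · simpa [expNeg] using (hasDerivAt_neg (w j)).exp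
    · simpa [expNeg, hj] using hasDerivAt_const (w i) (Real.exp (-w j))
  have h2 : HasFDerivAt ψ (fderiv ℝ ψ (expNeg w)) (expNeg (Function.update w i (w i))) := by
    rw [Function.update_eq_self]
    exact (hψ _).hasFDerivAt
  have h3 := h2.comp_hasDerivAt (w i) h1
  convert! h3 using 1
  rw [map_smul, partialDeriv]
  simp

/-! ### Laplace integrals: integration by parts -/

section Laplace

variable {V : Type*} [NormedAddCommGroup V] [NormedSpace ℂ V] {n : ℕ} {κ : Type*} [Fintype κ]
  (M : Fin n → V →L[ℂ] ℂ) (Q : κ → V →L[ℂ] ℂ) {l : κ → (Fin n → ℝ) → ℂ}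

theorem laplaceKernel_shift (c : Fin n → ℂ) (i : Fin n) (ψ : (Fin n → ℝ) → ℂ) (z : V)
    (w : Fin n → ℝ) : laplaceKernel M Q l (c + Pi.single i 1) ψ z w =
      Real.exp (-w i) * laplaceKernel M Q l c ψ z w := by
  rw [laplaceKernel, laplaceKernel, ← mul_assoc, Complex.ofReal_exp, ← Complex.exp_add]
  congr 2
  simp [Pi.single_apply, add_mul, Finset.sum_add_distrib]
  ring

/-- The three terms come from differentiating the monomial, `ψ` and the `l k`. In the last two the
chain rule for `v_i = exp(-w_i)` produces a factor `exp(-w_i)`, which is the same as raising `c i`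
by one. -/
theorem hasDerivAt_laplaceKernel (hl : ∀ k, ContDiff ℝ ∞ (l k)) (c : Fin n → ℂ)
    {ψ : (Fin n → ℝ) → ℂ} (hψ : ContDiff ℝ ∞ ψ) (i : Fin n) (z : V) (w : Fin n → ℝ) :
    HasDerivAt (fun t => laplaceKernel M Q l c ψ z (Function.update w i t))
      (-((M i z + c i) * laplaceKernel M Q l c ψ z w) -
        laplaceKernel M Q l (c + Pi.single i 1) (partialDeriv i ψ) z w -
        ∑ k, Q k z * laplaceKernel M Q l (c + Pi.single i 1)
          (fun v => ψ v * partialDeriv i (l k) v) z w) (w i) := by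
  have hd : (∞ : WithTop ℕ∞) ≠ 0 := by simp
  have h1 := hasDerivAt_comp_expNeg (hψ.differentiable hd) i w
  have h2 : HasDerivAt (fun t => ∑ k, Q k z * l k (expNeg (Function.update w i t)))
      (∑ k, Q k z * -(Real.exp (-w i) * partialDeriv i (l k) (expNeg w))) (w i) :=
    HasDerivAt.fun_sum fun k _ =>
      (hasDerivAt_comp_expNeg ((hl k).differentiable hd) i w).const_mul (Q k z)
  have h3 : HasDerivAt (fun t => -∑ j, (M j z + c j) * (Function.update w i t j : ℂ))
      (-(M i z + c i)) (w i) := by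
    have : HasDerivAt (fun t => ∑ j, (M j z + c j) * (Function.update w i t j : ℂ))
        (∑ j, (M j z + c j) * ((Pi.single i 1 : Fin n → ℝ) j : ℂ)) (w i) := by
      refine HasDerivAt.fun_sum fun j _ => HasDerivAt.const_mul _ ?_
      exact (hasDerivAt_pi.1 (hasDerivAt_update w i (w i)) j).ofReal_comp
    convert! this.neg using 1
    simp [Pi.single_apply, apply_ite Complex.ofReal]
  have h4 := ((h3.add h2).cexp).mul h1
  convert! h4 using 1
  simp only [laplaceKernel_shift]
  simp only [Pi.add_apply, Function.update_eq_self, laplaceKernel]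
  have : ∀ a b : ℂ, ∑ k, Q k z * (a * (b * (ψ (expNeg w) * partialDeriv i (l k) (expNeg w)))) =
      a * b * ψ (expNeg w) * ∑ k, Q k z * partialDeriv i (l k) (expNeg w) := by
    intro a b
    rw [Finset.mul_sum]
    exact Finset.sum_congr rfl fun k _ => by ring
  rw [this]
  have : ∑ k, Q k z * -(Real.exp (-w i) * partialDeriv i (l k) (expNeg w)) =
      -(Real.exp (-w i) * ∑ k, Q k z * partialDeriv i (l k) (expNeg w)) := by
    rw [Finset.mul_sum, ← Finset.sum_neg_distrib]
    exact Finset.sum_congr rfl fun k _ => by ring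
  rw [this]
  ring

theorem tendsto_laplaceKernel (hl : ∀ k, Continuous (l k)) {c : Fin n → ℂ}
    {ψ : (Fin n → ℝ) → ℂ} (hψ : Continuous ψ) {z : V} {i : Fin n} (hz : 0 < (M i z + c i).re)
    (w : Fin n → ℝ) :
    Tendsto (fun t => laplaceKernel M Q l c ψ z (Function.update w i t)) atTop (𝓝 0) := by
  have h1 : Tendsto (fun t => expNeg (Function.update w i t)) atTop
      (𝓝 (Function.update (expNeg w) i 0)) := by
    refine tendsto_pi_nhds.2 fun j => ?_
    rcases eq_or_ne j i with rfl | hj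
    · simpa [expNeg] using Real.tendsto_exp_neg_atTop_nhds_zero
    · simp [expNeg, hj]
  have h2 : Tendsto (fun t : ℝ => Complex.exp (-((M i z + c i) * t))) atTop (𝓝 0) := by
    rw [tendsto_zero_iff_norm_tendsto_zero]
    simp only [Complex.norm_exp, Complex.neg_re, Complex.re_mul_ofReal]
    exact Real.tendsto_exp_neg_atTop_nhds_zero.comp (tendsto_id.const_mul_atTop hz)
  have hg : Continuous fun v => Complex.exp (∑ k, Q k z * l k v) * ψ v := by fun_prop
  have h3 := (h2.mul_const (Complex.exp (-∑ j ∈ Finset.univ.erase i, (M j z + c j) * w j))).mul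
    ((hg.tendsto _).comp h1)
  simp only [zero_mul] at h3
  refine h3.congr fun t => ?_
  rw [laplaceKernel, Complex.exp_add, ← Complex.exp_add, Function.comp_apply, ← mul_assoc]
  congr 3
  rw [← Finset.add_sum_erase _ _ (Finset.mem_univ i), Function.update_self, neg_add]
  congr 2
  refine Finset.sum_congr rfl fun j hj => ?_
  rw [Function.update_of_ne (Finset.ne_of_mem_erase hj)]

theorem laplaceDomain_shift_subset (c : Fin n → ℂ) (i : Fin n) :
    laplaceDomain M c 0 ⊆ laplaceDomain M (c + Pi.single i 1) 0 := by
  intro z hz j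
  have h := hz j
  simp only [Pi.zero_apply, CharP.cast_eq_zero, neg_zero] at h ⊢
  rw [Pi.add_apply, ← add_assoc, Complex.add_re]
  rcases eq_or_ne j i with rfl | hj
  · rw [Pi.single_eq_same, Complex.one_re]
    linarith
  · simpa [hj] using h

/-- Integration by parts in `w_i`. This is the recursion behind the continuation: the right-hand
integrals either have the exponent `c i` raised by one or live on the face `w_i = 0`, so each of
them makes sense further to the left in direction `i`. -/
theorem laplaceInt_eq (hl : ∀ k, ContDiff ℝ ∞ (l k)) {c : Fin n → ℂ}
    {ψ : (Fin n → ℝ) → ℂ} (hψ : ContDiff ℝ ∞ ψ) {S : Finset (Fin n)} {i : Fin n} (hi : i ∈ S)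
    {z : V} (hz : z ∈ laplaceDomain M c 0) :
    (M i z + c i) * laplaceInt M Q l S c ψ z = laplaceInt M Q l (S.erase i) c ψ z -
      laplaceInt M Q l S (c + Pi.single i 1) (partialDeriv i ψ) z -
      ∑ k, Q k z * laplaceInt M Q l S (c + Pi.single i 1)
        (fun v => ψ v * partialDeriv i (l k) v) z := by
  have hz2 := laplaceDomain_shift_subset M c i hz
  have hlc := fun k => (hl k).continuous
  have i0 := (integrable_laplaceKernel M Q S hlc hψ.continuous hz).const_mul (M i z + c i)
  have i1 := integrable_laplaceKernel M Q S hlc (ContDiff.partialDeriv hψ i).continuous hz2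
  have i2 (k : κ) := (integrable_laplaceKernel M Q S hlc (ψ := fun v => ψ v * partialDeriv i (l k) v)
    (hψ.continuous.mul (ContDiff.partialDeriv (hl k) i).continuous) hz2).const_mul (Q k z)
  have i3 := integrable_finsetSum Finset.univ fun k _ => i2 k
  have key := integral_deriv_faceMeasure hi ((i0.neg.sub i1).sub i3)
    (integrable_laplaceKernel M Q (S.erase i) hlc hψ.continuous hz)
    (hasDerivAt_laplaceKernel M Q hl c hψ i z)
    (tendsto_laplaceKernel M Q hlc hψ.continuous (by simpa using hz i))
  simp only [laplaceInt]
  rw [← neg_eq_iff_eq_neg] at key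
  rw [← key]
  have e1 := integral_sub (i0.neg.sub i1) i3
  have e2 := integral_sub i0.neg i1
  simp only [Pi.sub_apply, Pi.neg_apply] at e1 e2 ⊢
  rw [e1, e2, integral_neg, integral_const_mul, integral_finsetSum _ fun k _ => i2 k]
  simp only [integral_const_mul]
  ring

end Laplace

/-! ### Continuation with denominators, and gluing to a meromorphic function -/

section Continuation

variable {V : Type*} [NormedAddCommGroup V] [NormedSpace ℂ V]

/-- An entire function whose zero set has empty interior. -/
def IsEntireNonzero (D : V → ℂ) : Prop := AnalyticOnNhd ℂ D Set.univ ∧ Dense {z | D z ≠ 0}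

theorem IsEntireNonzero.one : IsEntireNonzero (fun _ : V => (1 : ℂ)) :=
  ⟨analyticOnNhd_const, by simp⟩

theorem IsEntireNonzero.isOpen {D : V → ℂ} (hD : IsEntireNonzero D) : IsOpen {z | D z ≠ 0} :=
  isOpen_ne_fun (continuousOn_univ.1 hD.1.continuousOn) continuous_const

theorem IsEntireNonzero.mul {D D' : V → ℂ} (hD : IsEntireNonzero D) (hD' : IsEntireNonzero D') :
    IsEntireNonzero (fun z => D z * D' z) := by
  refine ⟨hD.1.mul hD'.1, ?_⟩
  convert! hD.2.inter_of_isOpen_left hD'.2 hD.isOpen using 1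
  ext z
  simp

theorem IsEntireNonzero.prod {α : Type*} (s : Finset α) {D : α → V → ℂ}
    (hD : ∀ k, IsEntireNonzero (D k)) : IsEntireNonzero (fun z => ∏ k ∈ s, D k z) := by
  induction s using Finset.cons_induction with
  | empty => simpa using IsEntireNonzero.one
  | cons k s hk ih => simpa [Finset.prod_cons] using (hD k).mul ih

/-- Through a zero `z`, the complex line `z + t • u` with `M u ≠ 0` leaves the zero set for every `t
≠ 0`. -/
theorem IsEntireNonzero.affine {M : V →L[ℂ] ℂ} (hM : M ≠ 0) (c : ℂ) :
    IsEntireNonzero (fun z => M z + c) := by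
  refine ⟨fun z _ => (M.analyticAt z).add analyticAt_const, ?_⟩
  obtain ⟨u, hu⟩ : ∃ u, M u ≠ 0 := by
    by_contra! h
    exact hM (ContinuousLinearMap.ext h)
  intro z
  rw [mem_closure_iff_frequently]
  by_cases hz : M z + c = 0
  · have h1 : Tendsto (fun t : ℂ => z + t • u) (𝓝[≠] 0) (𝓝 z) := by
      have : Continuous fun t : ℂ => z + t • u := by fun_prop
      simpa using (this.tendsto 0).mono_left nhdsWithin_le_nhds
    refine h1.frequently (Eventually.frequently ?_)
    filter_upwards [self_mem_nhdsWithin] with t ht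
    have : M (z + t • u) + c = t * M u := by
      rw [map_add, map_smul, smul_eq_mul]
      linear_combination hz
    rw [this]
    exact mul_ne_zero ht hu
  · have : Continuous fun z => M z + c := by fun_prop
    exact (this.continuousAt.eventually_ne hz).frequently

/-- After multiplication by an entire function the function `f` on `U₀` extends analytically
to `U`. -/
def HasContinuation (U₀ U : Set V) (f : V → ℂ) : Prop :=
  ∃ D G : V → ℂ, IsEntireNonzero D ∧ AnalyticOnNhd ℂ G U ∧ ∀ z ∈ U₀, D z * f z = G z

variable {U₀ U U₀' U' : Set V} {f g : V → ℂ}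

theorem HasContinuation.mono (hf : HasContinuation U₀ U f) (h₀ : U₀' ⊆ U₀) (h : U' ⊆ U) :
    HasContinuation U₀' U' f := by
  obtain ⟨D, G, hD, hG, he⟩ := hf
  exact ⟨D, G, hD, hG.mono h, fun z hz => he z (h₀ hz)⟩

theorem HasContinuation.congr (hf : HasContinuation U₀ U f) (h : ∀ z ∈ U₀, g z = f z) :
    HasContinuation U₀ U g := by
  obtain ⟨D, G, hD, hG, he⟩ := hf
  exact ⟨D, G, hD, hG, fun z hz => by rw [h z hz, he z hz]⟩

theorem HasContinuation.add (hf : HasContinuation U₀ U f) (hg : HasContinuation U₀ U g) :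
    HasContinuation U₀ U (fun z => f z + g z) := by
  obtain ⟨D, G, hD, hG, he⟩ := hf
  obtain ⟨D', G', hD', hG', he'⟩ := hg
  refine ⟨fun z => D z * D' z, fun z => D' z * G z + D z * G' z, hD.mul hD', ?_, fun z hz => ?_⟩
  · exact ((hD'.1.mono (Set.subset_univ _)).mul hG).add ((hD.1.mono (Set.subset_univ _)).mul hG')
  · simp only [← he z hz, ← he' z hz]
    ring

theorem HasContinuation.analytic_mul (hf : HasContinuation U₀ U f)
    (hg : AnalyticOnNhd ℂ g Set.univ) : HasContinuation U₀ U (fun z => g z * f z) := by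
  obtain ⟨D, G, hD, hG, he⟩ := hf
  refine ⟨D, fun z => g z * G z, hD, (hg.mono (Set.subset_univ _)).mul hG, fun z hz => ?_⟩
  simp only [← he z hz]
  ring

theorem HasContinuation.sub (hf : HasContinuation U₀ U f) (hg : HasContinuation U₀ U g) :
    HasContinuation U₀ U (fun z => f z - g z) :=
  (hf.add (hg.analytic_mul (g := fun _ => -1) analyticOnNhd_const)).congr fun z _ => by ring

theorem HasContinuation.sum {α : Type*} (s : Finset α) {f : α → V → ℂ}
    (hf : ∀ k, HasContinuation U₀ U (f k)) : HasContinuation U₀ U (fun z => ∑ k ∈ s, f k z) := by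
  induction s using Finset.cons_induction with
  | empty => exact ⟨fun _ => 1, fun _ => 0, IsEntireNonzero.one, analyticOnNhd_const, by simp⟩
  | cons k s hk ih => simpa [Finset.sum_cons] using (hf k).add ih

theorem HasContinuation.of_mul (hg : IsEntireNonzero g)
    (hf : HasContinuation U₀ U (fun z => g z * f z)) : HasContinuation U₀ U f := by
  obtain ⟨D, G, hD, hG, he⟩ := hf
  exact ⟨fun z => D z * g z, G, hD.mul hg, hG, fun z hz => by rw [← he z hz]; ring⟩

/-- Continuations to an exhausting sequence of connected sets define a meromorphic function. -/
theorem exists_isMeromorphic {U₀ : Set V} {U : ℕ → Set V} (h₀ : IsOpen U₀)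
    (hU : ∀ k, IsOpen (U k)) (hconn : ∀ k, IsPreconnected (U k)) (hmono : Monotone U)
    (hcover : ∀ z, ∃ k, z ∈ U k) (hsub : ∀ k, U₀ ⊆ U k)
    (hf : ∀ k, HasContinuation U₀ (U k) f) :
    ∃ T : V → ℂ, IsMeromorphic T ∧ ∀ z ∈ U₀, T z = f z := by
  classical
  rcases U₀.eq_empty_or_nonempty with rfl | ⟨y, hy⟩
  · refine ⟨0, fun z₀ => ⟨fun _ => 0, fun _ => 1, analyticAt_const, analyticAt_const, ?_, ?_⟩,
      by simp⟩
    · exact Eventually.frequently (by simp)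
    · simp
  choose D G hD hG he using hf
  -- Both sides equal `D k * D K * f` on the nonempty open set `U₀`, hence they agree on the
  -- connected set `U k` by the identity theorem. Clearing denominators avoids any appeal to zeros
  -- of `D k`.
  have hcross {k K : ℕ} (hkK : k ≤ K) : ∀ z ∈ U k, D K z * G k z = D k z * G K z := by
    have h1 : AnalyticOnNhd ℂ (fun z => D K z * G k z) (U k) :=
      ((hD K).1.mono (Set.subset_univ _)).mul (hG k)
    have h2 : AnalyticOnNhd ℂ (fun z => D k z * G K z) (U k) :=
      ((hD k).1.mono (Set.subset_univ _)).mul ((hG K).mono (hmono hkK))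
    refine h1.eqOn_of_preconnected_of_eventuallyEq h2 (hconn k) (hsub k hy) ?_
    filter_upwards [h₀.mem_nhds hy] with z hz
    rw [← he k z hz, ← he K z hz]
    ring
  let T : V → ℂ := fun z => if z ∈ U₀ then f z else
    G (Nat.find (hcover z)) z / D (Nat.find (hcover z)) z
  refine ⟨T, fun z₀ => ?_, fun z hz => if_pos hz⟩
  obtain ⟨K, hK⟩ := hcover z₀
  -- Near `z₀` the index selected in `T` is at most `K` but may vary with `z`. The local denominator
  -- therefore contains `D k` for every `k ≤ K`.
  have hP := IsEntireNonzero.prod (Finset.range K) hD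
  have hh := (hD K).mul hP
  refine ⟨fun z => G K z * ∏ k ∈ Finset.range K, D k z, fun z => D K z * ∏ k ∈ Finset.range K, D k z,
    (hG K z₀ hK).mul (hP.1 z₀ (Set.mem_univ _)), hh.1 z₀ (Set.mem_univ _),
    mem_closure_iff_frequently.1 (hh.2 z₀), ?_⟩
  filter_upwards [(hU K).mem_nhds hK] with z hz hne
  have hDK := left_ne_zero_of_mul hne
  have hDP := right_ne_zero_of_mul hne
  rw [mul_div_mul_right _ _ hDP, eq_div_iff hDK]
  by_cases hz0 : z ∈ U₀
  · simp only [T, if_pos hz0]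
    rw [mul_comm, he K z hz0]
  · simp only [T, if_neg hz0]
    have hle : Nat.find (hcover z) ≤ K := Nat.find_min' _ hz
    have hspec := Nat.find_spec (hcover z)
    set k := Nat.find (hcover z)
    have hDk : D k z ≠ 0 := by
      rcases hle.eq_or_lt with h | h
      · rwa [h]
      · exact Finset.prod_ne_zero_iff.1 hDP k (Finset.mem_range.2 h)
    rw [div_mul_eq_mul_div, div_eq_iff hDk]
    linear_combination hcross hle z hspec

end Continuation

/-! ### Meromorphic continuation of the Laplace integrals -/

section Laplace

variable {V : Type*} [NormedAddCommGroup V] [NormedSpace ℂ V] {n : ℕ} {κ : Type*} [Fintype κ]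
  (M : Fin n → V →L[ℂ] ℂ) (Q : κ → V →L[ℂ] ℂ) {l : κ → (Fin n → ℝ) → ℂ}

/-- On this face `w i` vanishes almost everywhere, so the exponent `c i` multiplies zero and can be
raised for free. -/
theorem laplaceInt_shift {S : Finset (Fin n)} {i : Fin n} (hi : i ∉ S) (c : Fin n → ℂ)
    (ψ : (Fin n → ℝ) → ℂ) (z : V) :
    laplaceInt M Q l S (c + Pi.single i 1) ψ z = laplaceInt M Q l S c ψ z := by
  have h : ∀ᵐ w ∂faceMeasure S, w i = 0 := by
    have : ∀ᵐ t ∂axisMeasure S i, t = 0 := by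
      rw [axisMeasure, if_neg hi, ae_dirac_eq]
      rfl
    exact (Measure.tendsto_eval_ae_ae (μ := axisMeasure S) (i := i)).eventually this
  refine integral_congr_ae ?_
  filter_upwards [h] with w hw
  simp [laplaceKernel_shift, hw]

/-- Induction on `∑ r_i`. If `i ∈ S`, one integration by parts gains a unit in direction `i` and
costs the denominator `M i z + c i`; if `i ∉ S`, the unit is gained for free. The faces and the
functions `ψ` change along the way, so the induction runs over all of them. -/
theorem hasContinuation_laplaceInt (hM : ∀ i, M i ≠ 0) (hl : ∀ k, ContDiff ℝ ∞ (l k))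
    (r : Fin n → ℕ) (c : Fin n → ℂ) (S : Finset (Fin n)) {ψ : (Fin n → ℝ) → ℂ}
    (hψ : ContDiff ℝ ∞ ψ) :
    HasContinuation (laplaceDomain M c 0) (laplaceDomain M c r) (laplaceInt M Q l S c ψ) := by
  induction hm : ∑ i, r i generalizing r c S ψ with
  | zero =>
    have hr : r = 0 := by
      ext i
      exact Finset.sum_eq_zero_iff.1 hm i (Finset.mem_univ i)
    subst hr
    exact ⟨fun _ => 1, _, IsEntireNonzero.one, fun z hz =>
      analyticAt_laplaceInt M Q S (fun k => (hl k).continuous) hψ.continuous hz, by simp⟩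
  | succ m ih =>
    obtain ⟨i, -, hi⟩ : ∃ i ∈ Finset.univ, r i ≠ 0 := by
      by_contra! h
      rw [Finset.sum_eq_zero h] at hm
      omega
    obtain ⟨r', rfl⟩ : ∃ r', r = r' + Pi.single i 1 := by
      refine ⟨r - Pi.single i 1, (tsub_add_cancel_of_le fun j => ?_).symm⟩
      rcases eq_or_ne j i with rfl | hj
      · simpa [Nat.one_le_iff_ne_zero] using hi
      · simp [hj]
    have hm' : ∑ j, r' j = m := by
      simp only [Pi.add_apply, Finset.sum_add_distrib, Finset.sum_pi_single', Finset.mem_univ,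
        if_true] at hm
      omega
    have hsub : laplaceDomain M c (r' + Pi.single i 1) ⊆
        laplaceDomain M (c + Pi.single i 1) r' := by
      intro z hz j
      have h := hz j
      rw [Pi.add_apply, ← add_assoc, Complex.add_re]
      rcases eq_or_ne j i with rfl | hj
      · simp only [Pi.add_apply, Pi.single_eq_same, Nat.cast_add, Nat.cast_one, Complex.one_re]
          at h ⊢
        linarith
      · simpa [hj] using h
    have step (S : Finset (Fin n)) {ψ : (Fin n → ℝ) → ℂ} (hψ : ContDiff ℝ ∞ ψ) :
        HasContinuation (laplaceDomain M c 0) (laplaceDomain M c (r' + Pi.single i 1))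
          (laplaceInt M Q l S (c + Pi.single i 1) ψ) :=
      (ih r' (c + Pi.single i 1) S hψ hm').mono (laplaceDomain_shift_subset M c i) hsub
    by_cases hiS : i ∈ S
    · refine HasContinuation.of_mul (IsEntireNonzero.affine (hM i) (c i)) ?_
      -- The boundary term still carries `c`, but its face omits `i`, so it equals the integral for
      -- `c + Pi.single i 1`, to which the induction hypothesis applies.
      have h1 : HasContinuation (laplaceDomain M c 0) (laplaceDomain M c (r' + Pi.single i 1))
          (laplaceInt M Q l (S.erase i) c ψ) :=
        (step (S.erase i) hψ).congr fun z _ => (laplaceInt_shift M Q (by simp) c ψ z).symm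
      refine ((h1.sub (step S (ContDiff.partialDeriv hψ i))).sub
        (HasContinuation.sum Finset.univ fun k => (step S (ψ := fun v => ψ v * partialDeriv i (l k) v)
          (hψ.mul (ContDiff.partialDeriv (hl k) i))).analytic_mul
          (g := Q k) fun z _ => (Q k).analyticAt z)).congr fun z hz => ?_
      exact laplaceInt_eq M Q hl hψ hiS hz
    · exact (step S hψ).congr fun z _ => (laplaceInt_shift M Q hiS c ψ z).symm

theorem isOpen_laplaceDomain (c : Fin n → ℂ) (r : Fin n → ℕ) : IsOpen (laplaceDomain M c r) := by
  simp only [laplaceDomain, Set.ofPred_forall]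
  refine isOpen_iInter_of_finite fun j => isOpen_lt continuous_const ?_
  exact Complex.continuous_re.comp (by fun_prop)

end Laplace

/-! ### Decomposition of the orthant into ordered, signed cones -/

section Charts

variable {n : ℕ}

/-- The real number `1` or `-1`. -/
def signOf (b : Bool) : ℝ := if b then 1 else -1

theorem signOf_mul_self (b : Bool) : signOf b * signOf b = 1 := by cases b <;> simp [signOf]

theorem abs_signOf (b : Bool) : |signOf b| = 1 := by cases b <;> simp [signOf]

/-- The sum of the `w_k` with `k ≤ τ⁻¹ i`. -/
def chainSum (τ : Equiv.Perm (Fin n)) (w : Fin n → ℝ) (i : Fin n) : ℝ :=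
  ∑ k ∈ Finset.Iic (τ.symm i), w k

/-- The matrix of the linear map from the orthant onto the cone of the vectors `y` with signs `ε`
and `|y_{τ 1}| < |y_{τ 2}| < ⋯`. -/
def coneMatrix (τ : Equiv.Perm (Fin n)) (ε : Fin n → Bool) : Matrix (Fin n) (Fin n) ℝ :=
  Matrix.of fun i k => signOf (ε i) * if k ≤ τ.symm i then 1 else 0

theorem coneMatrix_mulVec (τ : Equiv.Perm (Fin n)) (ε : Fin n → Bool) (w : Fin n → ℝ)
    (i : Fin n) : (coneMatrix τ ε *ᵥ w) i = signOf (ε i) * chainSum τ w i := by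
  have : Finset.Iic (τ.symm i) = Finset.univ.filter (· ≤ τ.symm i) := by ext; simp
  simp [coneMatrix, Matrix.mulVec, dotProduct, chainSum, Finset.mul_sum, this, Finset.sum_filter]

/-- Up to signs and a permutation of its rows, the matrix is lower triangular with ones on the
diagonal. -/
theorem abs_det_coneMatrix (τ : Equiv.Perm (Fin n)) (ε : Fin n → Bool) :
    |(coneMatrix τ ε).det| = 1 := by
  let B : Matrix (Fin n) (Fin n) ℝ := Matrix.of fun i k => if k ≤ i then 1 else 0
  have h : coneMatrix τ ε = Matrix.diagonal (fun i => signOf (ε i)) * B.submatrix τ.symm id := by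
    ext i k
    simp [coneMatrix, B, Matrix.diagonal_mul]
  have hB : B.det = 1 := by
    rw [Matrix.det_of_isLowerTriangular]
    · simp [B]
    · intro i k hik
      simpa [B] using hik
  rw [h, Matrix.det_mul, Matrix.det_diagonal, Matrix.det_permute, hB, abs_mul, abs_mul,
    Finset.abs_prod]
  simp only [abs_signOf, Finset.prod_const_one, one_mul, abs_one, mul_one]
  rcases Int.units_eq_one_or (Equiv.Perm.sign τ.symm) with h | h <;> rw [h] <;> simp

/-- The cone of the vectors `y` with signs `ε` and `|y_{τ 1}| < |y_{τ 2}| < ⋯`. -/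
def signedCone (τ : Equiv.Perm (Fin n)) (ε : Fin n → Bool) : Set (Fin n → ℝ) :=
  (fun w => coneMatrix τ ε *ᵥ w) '' orthant n

theorem isOpen_orthant : IsOpen (orthant n) := by
  simp only [orthant, Set.ofPred_forall]
  exact isOpen_iInter_of_finite fun j => isOpen_lt continuous_const (continuous_apply j)

theorem strictMono_sum_Iic {w : Fin n → ℝ} (hw : w ∈ orthant n) :
    StrictMono fun j => ∑ k ∈ Finset.Iic j, w k := by
  intro i j hij
  refine Finset.sum_lt_sum_of_subset (Finset.Iic_subset_Iic.2 hij.le) (i := j) (by simp)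
    (by simpa using hij) (hw j) fun k _ _ => (hw k).le

/-- The witnesses are the successive differences of `a`, positive because `a` is strictly increasing
and starts above `0`. -/
theorem exists_sum_Iic_eq {a : Fin n → ℝ} (ha : StrictMono a) (h0 : ∀ j, 0 < a j) :
    ∃ w ∈ orthant n, ∀ j, ∑ k ∈ Finset.Iic j, w k = a j := by
  obtain _ | m := n
  · exact ⟨a, h0, fun j => j.elim0⟩
  refine ⟨Fin.cons (a 0) fun k => a k.succ - a k.castSucc, fun j => ?_, fun j => ?_⟩
  · refine Fin.cases ?_ (fun k => ?_) j
    · simpa using h0 0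
    · simpa using ha k.castSucc_lt_succ
  · induction j using Fin.induction with
    | zero =>
      have : Finset.Iic (0 : Fin (m + 1)) = {0} := by ext; simp
      simp [this]
    | succ k ih =>
      have : Finset.Iic k.succ = insert k.succ (Finset.Iic k.castSucc) := by
        ext x
        simp only [Finset.mem_Iic, Finset.mem_insert, Fin.le_def, Fin.ext_iff, Fin.val_succ,
          Fin.val_castSucc]
        omega
      rw [this, Finset.sum_insert (by simp [Fin.le_def]), ih]
      simp

theorem mem_signedCone_iff {τ : Equiv.Perm (Fin n)} {ε : Fin n → Bool} {y : Fin n → ℝ} :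
    y ∈ signedCone τ ε ↔
      (∀ i, 0 < signOf (ε i) * y i) ∧ StrictMono fun j => signOf (ε (τ j)) * y (τ j) := by
  constructor
  · rintro ⟨w, hw, rfl⟩
    have h (i : Fin n) : signOf (ε i) * (coneMatrix τ ε *ᵥ w) i = chainSum τ w i := by
      rw [coneMatrix_mulVec, ← mul_assoc, signOf_mul_self, one_mul]
    simp only [h]
    refine ⟨fun i => ?_, ?_⟩
    · exact Finset.sum_pos (fun k _ => hw k) ⟨τ.symm i, by simp⟩
    · simpa [chainSum] using strictMono_sum_Iic hw
  · rintro ⟨h0, h1⟩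
    obtain ⟨w, hw, h⟩ := exists_sum_Iic_eq h1 fun j => h0 (τ j)
    refine ⟨w, hw, funext fun i => ?_⟩
    simp only
    rw [coneMatrix_mulVec, chainSum, h, τ.apply_symm_apply, ← mul_assoc, signOf_mul_self, one_mul]

theorem signOf_mul_eq_abs {b : Bool} {t : ℝ} (h : 0 < signOf b * t) : signOf b * t = |t| := by
  rw [← abs_of_pos h, abs_mul, abs_signOf, one_mul]

/-- A point of a cone determines `ε` through the signs of its coordinates, and `τ` as the unique
permutation sorting the distinct values `|y i|`. -/
theorem pairwise_disjoint_signedCone :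
    Pairwise (Function.onFun Disjoint fun x : Equiv.Perm (Fin n) × (Fin n → Bool) =>
      signedCone x.1 x.2) := by
  rintro ⟨τ, ε⟩ ⟨τ', ε'⟩ hne
  refine Set.disjoint_left.2 fun y hy hy' => hne ?_
  rw [mem_signedCone_iff] at hy hy'
  obtain ⟨h0, h1⟩ := hy
  obtain ⟨h0', h1'⟩ := hy'
  have hε : ε = ε' := by
    ext i
    have := h0 i
    have := h0' i
    cases hi : ε i <;> cases hi' : ε' i <;> simp_all [signOf] <;> linarith
  subst hε
  simp only [signOf_mul_eq_abs (h0 _)] at h1 h1'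
  have h2 := Tuple.unique_monotone (f := fun i => |y i|) h1.monotone h1'.monotone
  have hinj : Function.Injective fun i => |y i| := by
    intro i j hij
    have := h1.injective (a₁ := τ.symm i) (a₂ := τ.symm j) (by simpa using hij)
    simpa using this
  have hτ : τ = τ' := Equiv.ext fun j => hinj (congrFun h2 j)
  rw [hτ]

theorem ae_ne_zero_of_linear {L : (Fin n → ℝ) →ₗ[ℝ] ℝ} (hL : L ≠ 0) :
    ∀ᵐ y : Fin n → ℝ, L y ≠ 0 := by
  have h := Measure.addHaar_submodule (volume : Measure (Fin n → ℝ)) (LinearMap.ker L)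
    (by rwa [ne_eq, LinearMap.ker_eq_top])
  rw [ae_iff]
  convert! h using 2
  ext y
  simp

/-- Outside the hyperplanes `y i = 0` and `y i = ± y j`, which are finitely many null sets, the
absolute values are positive and distinct and can be sorted strictly. -/
theorem ae_mem_iUnion_signedCone :
    ∀ᵐ y : Fin n → ℝ, y ∈ ⋃ x : Equiv.Perm (Fin n) × (Fin n → Bool), signedCone x.1 x.2 := by
  have h1 : ∀ᵐ y : Fin n → ℝ, ∀ i, y i ≠ 0 := ae_all_iff.2 fun i =>
    ae_ne_zero_of_linear (L := LinearMap.proj i) fun h => by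
      simpa using LinearMap.congr_fun h (Pi.single i 1)
  have h2 : ∀ᵐ y : Fin n → ℝ, ∀ i j, i ≠ j → y i - y j ≠ 0 := ae_all_iff.2 fun i =>
    ae_all_iff.2 fun j => by
      by_cases hij : i = j
      · simp [hij]
      · filter_upwards [ae_ne_zero_of_linear
          (L := LinearMap.proj (R := ℝ) (φ := fun _ => ℝ) i -
            LinearMap.proj (R := ℝ) (φ := fun _ => ℝ) j) fun h => by
            simpa [Ne.symm hij] using LinearMap.congr_fun h (Pi.single i 1)] with y hy _
        simpa using hy
  have h3 : ∀ᵐ y : Fin n → ℝ, ∀ i j, i ≠ j → y i + y j ≠ 0 := ae_all_iff.2 fun i =>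
    ae_all_iff.2 fun j => by
      by_cases hij : i = j
      · simp [hij]
      · filter_upwards [ae_ne_zero_of_linear
          (L := LinearMap.proj (R := ℝ) (φ := fun _ => ℝ) i +
            LinearMap.proj (R := ℝ) (φ := fun _ => ℝ) j) fun h => by
            simpa [Ne.symm hij] using LinearMap.congr_fun h (Pi.single i 1)] with y hy _
        simpa using hy
  filter_upwards [h1, h2, h3] with y h1 h2 h3
  let a : Fin n → ℝ := fun i => |y i|
  have ha : Function.Injective a := by
    intro i j hij
    by_contra hne
    rcases abs_eq_abs.1 hij with h | h
    · exact h2 i j hne (by linarith)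
    · exact h3 i j hne (by linarith)
  let ε : Fin n → Bool := fun i => decide (0 < y i)
  have hε (i : Fin n) : signOf (ε i) * y i = a i := by
    by_cases h : 0 < y i
    · simp [ε, signOf, h, a, abs_of_pos h]
    · simp [ε, signOf, h, a, abs_of_nonpos (not_lt.1 h)]
  refine Set.mem_iUnion.2 ⟨(Tuple.sort a, ε), mem_signedCone_iff.2 ⟨fun i => ?_, ?_⟩⟩
  · rw [hε]
    exact abs_pos.2 (h1 i)
  · simp only [hε]
    exact (Tuple.monotone_sort a).strictMono_of_injective (ha.comp (Tuple.sort a).injective)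

/-- The coordinates on the part of the orthant where `log x` lies in `signedCone τ ε`. -/
def chart (τ : Equiv.Perm (Fin n)) (ε : Fin n → Bool) (w : Fin n → ℝ) : Fin n → ℝ :=
  fun i => Real.exp (signOf (ε i) * chainSum τ w i)

theorem image_exp_univ : (fun (y : Fin n → ℝ) i => Real.exp (y i)) '' Set.univ = orthant n := by
  ext x
  simp only [Set.image_univ, Set.mem_range, orthant, Set.mem_ofPred_eq]
  constructor
  · rintro ⟨y, rfl⟩ j
    exact Real.exp_pos _
  · intro h
    exact ⟨fun i => Real.log (x i), funext fun i => Real.exp_log (h i)⟩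

theorem hasFDerivAt_exp_pi (y : Fin n → ℝ) :
    HasFDerivAt (fun (y : Fin n → ℝ) i => Real.exp (y i))
      (LinearMap.toContinuousLinearMap (Matrix.toLin' (Matrix.diagonal fun i => Real.exp (y i)))) y := by
  refine hasFDerivAt_pi'.2 fun i => ?_
  have h := (hasFDerivAt_apply (𝕜 := ℝ) i y).exp
  convert! h using 1
  ext v
  simp [Matrix.mulVec_diagonal]

/-- Two changes of variables: `x = exp y`, whose Jacobian is `∏ x_i`, and the linear map of each
cone, whose Jacobian is `1`. The cones are disjoint and cover almost everything. -/
theorem integral_orthant_eq_sum {f : (Fin n → ℝ) → ℂ}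
    (hf : ∀ (τ : Equiv.Perm (Fin n)) (ε : Fin n → Bool),
      IntegrableOn (fun w => (∏ i, chart τ ε w i) • f (chart τ ε w)) (orthant n)) :
    IntegrableOn f (orthant n) ∧ ∫ x in orthant n, f x =
      ∑ x : Equiv.Perm (Fin n) × (Fin n → Bool),
        ∫ w in orthant n, (∏ i, chart x.1 x.2 w i) • f (chart x.1 x.2 w) := by
  let g : (Fin n → ℝ) → ℂ := fun y => (∏ i, Real.exp (y i)) • f fun i => Real.exp (y i)
  have hinj : Function.Injective fun (y : Fin n → ℝ) i => Real.exp (y i) := fun y y' h =>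
    funext fun i => Real.exp_injective (congrFun h i)
  have hdet (y : Fin n → ℝ) : |(LinearMap.toContinuousLinearMap
      (Matrix.toLin' (Matrix.diagonal fun i => Real.exp (y i)))).det| = ∏ i, Real.exp (y i) := by
    rw [LinearMap.det_toContinuousLinearMap, LinearMap.det_toLin', Matrix.det_diagonal,
      abs_of_nonneg (Finset.prod_nonneg fun i _ => (Real.exp_pos _).le)]
  have e1 := integral_image_eq_integral_abs_det_fderiv_smul volume MeasurableSet.univ
    (fun y _ => (hasFDerivAt_exp_pi (n := n) y).hasFDerivWithinAt) hinj.injOn f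
  have e2 := integrableOn_image_iff_integrableOn_abs_det_fderiv_smul volume MeasurableSet.univ
    (fun y _ => (hasFDerivAt_exp_pi (n := n) y).hasFDerivWithinAt) hinj.injOn f
  rw [image_exp_univ] at e1 e2
  simp only [hdet] at e1 e2
  rw [e1, e2]
  have hlin (τ : Equiv.Perm (Fin n)) (ε : Fin n → Bool) (w : Fin n → ℝ) :
      HasFDerivWithinAt (fun w => coneMatrix τ ε *ᵥ w)
        (LinearMap.toContinuousLinearMap (Matrix.toLin' (coneMatrix τ ε))) (orthant n) w :=
    (LinearMap.toContinuousLinearMap (Matrix.toLin' (coneMatrix τ ε))).hasFDerivWithinAt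
  have hdet2 (τ : Equiv.Perm (Fin n)) (ε : Fin n → Bool) :
      |(LinearMap.toContinuousLinearMap (Matrix.toLin' (coneMatrix τ ε))).det| = 1 := by
    rw [LinearMap.det_toContinuousLinearMap, LinearMap.det_toLin', abs_det_coneMatrix]
  have hinj2 (τ : Equiv.Perm (Fin n)) (ε : Fin n → Bool) :
      Set.InjOn (fun w => coneMatrix τ ε *ᵥ w) (orthant n) := by
    refine (Matrix.mulVec_injective_of_isUnit ?_).injOn
    rw [Matrix.isUnit_iff_isUnit_det, isUnit_iff_ne_zero, ← abs_ne_zero, abs_det_coneMatrix]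
    exact one_ne_zero
  have hgw (τ : Equiv.Perm (Fin n)) (ε : Fin n → Bool) (w : Fin n → ℝ) :
      g (coneMatrix τ ε *ᵥ w) = (∏ i, chart τ ε w i) • f (chart τ ε w) := by
    simp only [g, coneMatrix_mulVec]
    rfl
  have hms (x : Equiv.Perm (Fin n) × (Fin n → Bool)) : MeasurableSet (signedCone x.1 x.2) :=
    isOpen_orthant.measurableSet.image_of_continuousOn_injOn
      (by fun_prop) (hinj2 x.1 x.2)
  have hint (x : Equiv.Perm (Fin n) × (Fin n → Bool)) : IntegrableOn g (signedCone x.1 x.2) := by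
    rw [signedCone, integrableOn_image_iff_integrableOn_abs_det_fderiv_smul volume
      isOpen_orthant.measurableSet (fun w _ => hlin x.1 x.2 w) (hinj2 x.1 x.2)]
    simpa only [hdet2, one_smul, hgw] using hf x.1 x.2
  have hU : (⋃ x : Equiv.Perm (Fin n) × (Fin n → Bool), signedCone x.1 x.2 : Set (Fin n → ℝ))
      =ᵐ[volume] Set.univ := by
    refine eventuallyEq_univ.2 ae_mem_iUnion_signedCone
  refine ⟨(integrableOn_congr_set_ae hU).1 (integrableOn_finite_iUnion.2 hint), ?_⟩
  rw [← setIntegral_congr_set hU, integral_iUnion_fintype hms pairwise_disjoint_signedCone hint]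
  refine Finset.sum_congr rfl fun x _ => ?_
  rw [signedCone, integral_image_eq_integral_abs_det_fderiv_smul volume
    isOpen_orthant.measurableSet (fun w _ => hlin x.1 x.2 w) (hinj2 x.1 x.2)]
  simp only [hdet2, one_smul]
  exact integral_congr_ae (.of_forall fun w => hgw x.1 x.2 w)

end Charts

/-! ### The radial weight in the charts, and the analytic half of the theorem -/

section Radial

variable {n : ℕ}

/-- The product of the `v_k` with `k ≤ τ⁻¹ i`. -/
def chainProd (τ : Equiv.Perm (Fin n)) (v : Fin n → ℝ) (i : Fin n) : ℝ :=
  ∏ k ∈ Finset.Iic (τ.symm i), v k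

theorem chainProd_expNeg (τ : Equiv.Perm (Fin n)) (w : Fin n → ℝ) (i : Fin n) :
    chainProd τ (expNeg w) i = Real.exp (-chainSum τ w i) := by
  rw [chainProd, chainSum, ← Finset.sum_neg_distrib, Real.exp_sum]
  rfl

theorem contDiff_chainProd (τ : Equiv.Perm (Fin n)) (i : Fin n) :
    ContDiff ℝ ∞ fun v => chainProd τ v i := by
  unfold chainProd
  fun_prop

/-- The function `log (1 + u_i²)`, where `u_i` is the product of the `v_k` with `k ≤ τ⁻¹ i`. -/
def logWeight (τ : Equiv.Perm (Fin n)) (i : Fin n) (v : Fin n → ℝ) : ℂ :=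
  (Real.log (1 + chainProd τ v i ^ 2) : ℝ)

theorem contDiff_logWeight (τ : Equiv.Perm (Fin n)) (i : Fin n) :
    ContDiff ℝ ∞ (logWeight τ i) := by
  have h1 : ContDiff ℝ ∞ fun v => Real.log (1 + chainProd τ v i ^ 2) :=
    (contDiff_const.add ((contDiff_chainProd τ i).pow 2)).log fun v => by positivity
  exact Complex.ofRealCLM.contDiff.comp h1

/-- The linear part of the exponent of `v_k` in the chart for `(τ, ε)`. -/
def rate (a : Fin n → ℕ) (τ : Equiv.Perm (Fin n)) (ε : Fin n → Bool) (k : Fin n) :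
    ℂ × ℂ →L[ℂ] ℂ :=
  ∑ i with k ≤ τ.symm i, (a i : ℂ) • if ε i then
    ContinuousLinearMap.fst ℂ ℂ ℂ - ContinuousLinearMap.snd ℂ ℂ ℂ else
    ContinuousLinearMap.snd ℂ ℂ ℂ

/-- The constant part of the exponent of `v_k` in the chart for `(τ, ε)`. -/
def rateConst (μ : ℝ) (b c : Fin n → ℝ) (τ : Equiv.Perm (Fin n)) (ε : Fin n → Bool)
    (k : Fin n) : ℂ :=
  ∑ i with k ≤ τ.symm i, ((if ε i then b i + μ - c i - 1 else c i + 1 : ℝ) : ℂ)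

theorem rate_add_rateConst (a : Fin n → ℕ) (μ : ℝ) (b c : Fin n → ℝ) (τ : Equiv.Perm (Fin n))
    (ε : Fin n → Bool) (k : Fin n) (z : ℂ × ℂ) : rate a τ ε k z + rateConst μ b c τ ε k =
      ∑ i with k ≤ τ.symm i, if ε i then
        (z.1 * a i + b i + μ) - (z.2 * a i + c i) - 1 else z.2 * a i + c i + 1 := by
  rw [rate, rateConst, _root_.sum_apply, ← Finset.sum_add_distrib]
  refine Finset.sum_congr rfl fun i _ => ?_
  split_ifs
  · simp only [_root_.smul_apply, _root_.sub_apply, ContinuousLinearMap.coe_fst',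
      ContinuousLinearMap.coe_snd', smul_eq_mul]
    push_cast
    ring
  · simp only [_root_.smul_apply, ContinuousLinearMap.coe_snd', smul_eq_mul]
    push_cast
    ring

/-- At `(s, t) = (2, 1)` both `s - t` and `t` equal `1`. Every summand then contributes `a i > 0`,
whatever the signs, so nothing cancels. -/
theorem rate_ne_zero {a : Fin n → ℕ} (ha : ∀ j, 0 < a j) (τ : Equiv.Perm (Fin n))
    (ε : Fin n → Bool) (k : Fin n) : rate a τ ε k ≠ 0 := by
  intro h
  have h1 : rate a τ ε k (2, 1) = ((∑ i with k ≤ τ.symm i, a i : ℕ) : ℂ) := by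
    rw [rate, _root_.sum_apply, Nat.cast_sum]
    refine Finset.sum_congr rfl fun i _ => ?_
    split_ifs
    · simp only [_root_.smul_apply, _root_.sub_apply, ContinuousLinearMap.coe_fst',
        ContinuousLinearMap.coe_snd', smul_eq_mul]
      norm_num
    · simp
  rw [h] at h1
  have h2 : 0 < ∑ i with k ≤ τ.symm i, a i := Finset.sum_pos (fun i _ => ha i) ⟨τ k, by simp⟩
  simp only [_root_.zero_apply] at h1
  exact h2.ne (by exact_mod_cast h1)

theorem mem_domainD {μ : ℝ} {a : Fin n → ℕ} (ha : ∀ j, 0 < a j) {b c : Fin n → ℝ} {z : ℂ × ℂ}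
    (hz : z ∈ domainD μ a b c) (j : Fin n) :
    0 < z.2.re * a j + c j + 1 ∧ 0 < (z.1.re * a j + b j + μ) - (z.2.re * a j + c j) - 1 := by
  have haj : (0 : ℝ) < a j := by exact_mod_cast ha j
  obtain ⟨h1, h2⟩ := hz
  have h3 := (le_ciSup (f := fun j => (-1 - c j) / (a j : ℝ)) (Set.finite_range _).bddAbove j).trans_lt h1
  have h4 := ciInf_le (f := fun j => (b j + μ - 1 - c j) / (a j : ℝ)) (Set.finite_range _).bddBelow j
  have h5 : z.2.re - z.1.re < (b j + μ - 1 - c j) / (a j : ℝ) := by linarith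
  rw [div_lt_iff₀ haj] at h3
  rw [lt_div_iff₀ haj] at h5
  constructor <;> linarith

theorem isOpen_domainD (μ : ℝ) (a : Fin n → ℕ) (b c : Fin n → ℝ) : IsOpen (domainD μ a b c) := by
  have h1 : Continuous fun z : ℂ × ℂ => z.1.re := Complex.continuous_re.comp continuous_fst
  have h2 : Continuous fun z : ℂ × ℂ => z.2.re := Complex.continuous_re.comp continuous_snd
  exact (isOpen_lt continuous_const h2).inter (isOpen_lt h2 (h1.add continuous_const))

/-- Each exponent of a `v_k` is a nonempty sum of the quantities from `mem_domainD`: convergence at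
`x_i = 0` where `ε i` is false, at `x_i = ∞` where it is true. -/
theorem domainD_subset_laplaceDomain {μ : ℝ} {a : Fin n → ℕ} (ha : ∀ j, 0 < a j)
    {b c : Fin n → ℝ} (τ : Equiv.Perm (Fin n)) (ε : Fin n → Bool) :
    domainD μ a b c ⊆ laplaceDomain (rate a τ ε) (rateConst μ b c τ ε) 0 := by
  intro z hz k
  rw [rate_add_rateConst, Complex.re_sum]
  simp only [Pi.zero_apply, Nat.cast_zero, neg_zero]
  refine Finset.sum_pos (fun i _ => ?_) ⟨τ k, by simp⟩
  have := mem_domainD ha hz i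
  split_ifs
  · simpa using this.2
  · simpa using this.1

/-- The weight of the radial integrals. -/
def radialWeight (μ : ℝ) (a : Fin n → ℕ) (b c : Fin n → ℝ) (z : ℂ × ℂ) (x : Fin n → ℝ) : ℂ :=
  ∏ j, (x j : ℂ) ^ (z.2 * a j + c j) /
    ((1 + x j ^ 2 : ℝ) : ℂ) ^ ((z.1 * a j + b j + μ) / 2)

theorem ofReal_cpow_eq_exp {x : ℝ} (hx : 0 < x) (α : ℂ) :
    (x : ℂ) ^ α = Complex.exp (Real.log x * α) := by
  rw [Complex.cpow_def_of_ne_zero (by exact_mod_cast hx.ne'), Complex.ofReal_log hx.le]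

/-- The leading factor is the Jacobian of `x = exp y`. The inversion `x ↦ 1/x` turns a large
coordinate into a small one, so for both signs the same smooth factor `log (1 + u²)` with `u =
exp(-A) ≤ 1` (for `A ≥ 0`) remains. -/
theorem weight_chart_eq (α β : ℂ) (bl : Bool) (A : ℝ) :
    (Real.exp (signOf bl * A) : ℂ) * ((Real.exp (signOf bl * A) : ℂ) ^ α /
      ((1 + Real.exp (signOf bl * A) ^ 2 : ℝ) : ℂ) ^ (β / 2)) =
    Complex.exp (-((if bl then β - α - 1 else α + 1) * A) +
      -(β / 2) * (Real.log (1 + Real.exp (-A) ^ 2) : ℝ)) := by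
  have hpos : (0 : ℝ) < 1 + Real.exp (signOf bl * A) ^ 2 := by positivity
  rw [ofReal_cpow_eq_exp (Real.exp_pos _), ofReal_cpow_eq_exp hpos, Real.log_exp,
    Complex.ofReal_exp, ← Complex.exp_sub, ← Complex.exp_add]
  congr 1
  cases bl
  · simp [signOf]
    ring
  -- Factor `exp (2A)` out of `1 + exp (2A)`.
  · have : Real.log (1 + Real.exp A ^ 2) = 2 * A + Real.log (1 + Real.exp (-A) ^ 2) := by
      have h : 1 + Real.exp A ^ 2 = Real.exp (2 * A) * (1 + Real.exp (-A) ^ 2) := by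
        rw [mul_add, ← Real.exp_nat_mul, ← Real.exp_nat_mul, ← Real.exp_add]
        simp [add_comm]
      rw [h, Real.log_mul (Real.exp_pos _).ne' (by positivity), Real.log_exp]
    simp only [signOf, if_true, one_mul, this]
    push_cast
    ring

/-- The smooth factor in the chart for `(τ, ε)`. -/
def chartFactor (μ : ℝ) (b : Fin n → ℝ) (τ : Equiv.Perm (Fin n)) (ψ : (Fin n → ℝ) → ℂ)
    (v : Fin n → ℝ) : ℂ :=
  Complex.exp (∑ i, -((b i + μ : ℝ) / 2 : ℂ) * logWeight τ i v) * ψ v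

theorem contDiff_chartFactor (μ : ℝ) (b : Fin n → ℝ) (τ : Equiv.Perm (Fin n))
    {ψ : (Fin n → ℝ) → ℂ} (hψ : ContDiff ℝ ∞ ψ) : ContDiff ℝ ∞ (chartFactor μ b τ ψ) := by
  refine ContDiff.mul (ContDiff.cexp ?_) hψ
  exact ContDiff.sum fun i _ => contDiff_const.mul (contDiff_logWeight τ i)

/-- The linear part of the exponent of `1 + u_i²`. -/
def weightRate (a : Fin n → ℕ) (i : Fin n) : ℂ × ℂ →L[ℂ] ℂ :=
  (-(a i : ℂ) / 2) • ContinuousLinearMap.fst ℂ ℂ ℂ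

/-- The exponent of `1 + u_i²` is split: its part linear in `z` goes into `weightRate`, its constant
part into `chartFactor`. The exponents of the `v_k` arise by interchanging the sums over `i` and
over `k ≤ τ⁻¹ i`. -/
theorem radialWeight_chart (μ : ℝ) (a : Fin n → ℕ) (b c : Fin n → ℝ) (z : ℂ × ℂ)
    (τ : Equiv.Perm (Fin n)) (ε : Fin n → Bool) (ψ : (Fin n → ℝ) → ℂ) (w : Fin n → ℝ) :
    (∏ i, chart τ ε w i) • (radialWeight μ a b c z (chart τ ε w) * ψ (expNeg w)) =
      laplaceKernel (rate a τ ε) (weightRate a) (logWeight τ) (rateConst μ b c τ ε)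
        (chartFactor μ b τ ψ) z w := by
  rw [Complex.real_smul, radialWeight, ← mul_assoc, Complex.ofReal_prod,
    ← Finset.prod_mul_distrib, laplaceKernel, chartFactor, ← mul_assoc, ← Complex.exp_add]
  simp only [chart, weight_chart_eq]
  rw [← Complex.exp_sum]
  congr 2
  have h1 : ∑ k, (rate a τ ε k z + rateConst μ b c τ ε k) * (w k : ℂ) =
      ∑ i, (if ε i then (z.1 * a i + b i + μ) - (z.2 * a i + c i) - 1 else
        z.2 * a i + c i + 1) * (chainSum τ w i : ℂ) := by
    simp only [rate_add_rateConst, chainSum, Complex.ofReal_sum, Finset.sum_mul, Finset.mul_sum,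
      Finset.sum_filter]
    rw [Finset.sum_comm]
    refine Finset.sum_congr rfl fun i _ => ?_
    have : Finset.Iic (τ.symm i) = Finset.univ.filter (· ≤ τ.symm i) := by ext; simp
    rw [this, Finset.sum_filter]
    simp only [ite_mul, zero_mul]
  rw [h1, Finset.sum_add_distrib, Finset.sum_neg_distrib, add_assoc, ← Finset.sum_add_distrib]
  congr 1
  refine Finset.sum_congr rfl fun i _ => ?_
  simp only [weightRate, logWeight, chainProd_expNeg, _root_.smul_apply,
    ContinuousLinearMap.coe_fst', smul_eq_mul]
  push_cast
  ring

theorem convex_laplaceDomain (M : Fin n → ℂ × ℂ →L[ℂ] ℂ) (c : Fin n → ℂ) (r : Fin n → ℕ) :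
    Convex ℝ (laplaceDomain M c r) := by
  have : laplaceDomain M c r = ⋂ j, {z | -(r j : ℝ) - (c j).re < (M j z).re} := by
    ext z
    simp [laplaceDomain, sub_lt_iff_lt_add]
  rw [this]
  refine convex_iInter fun j => ?_
  exact convex_halfSpace_gt (f := fun z => (M j z).re) ⟨by simp, by simp⟩ _

/-- Only one property of the remaining factor `h` matters: in every chart it extends to a smooth
function of `v = exp(-w)`, including the faces `v_k = 0`. -/
theorem radial_continuation (μ : ℝ) {a : Fin n → ℕ} (ha : ∀ j, 0 < a j) (b c : Fin n → ℝ)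
    {h : (Fin n → ℝ) → ℂ}
    (hh : ∀ (τ : Equiv.Perm (Fin n)) (ε : Fin n → Bool), ∃ ψ : (Fin n → ℝ) → ℂ,
      ContDiff ℝ ∞ ψ ∧ ∀ w ∈ orthant n, h (chart τ ε w) = ψ (expNeg w)) :
    (∀ z ∈ domainD μ a b c, IntegrableOn (fun x => radialWeight μ a b c z x * h x) (orthant n)) ∧
    AnalyticOnNhd ℂ (fun z => ∫ x in orthant n, radialWeight μ a b c z x * h x)
      (domainD μ a b c) ∧
    ∃ T : ℂ × ℂ → ℂ, IsMeromorphic T ∧ ∀ z ∈ domainD μ a b c,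
      T z = ∫ x in orthant n, radialWeight μ a b c z x * h x := by
  choose ψ hψ hψe using hh
  have hl (τ : Equiv.Perm (Fin n)) (k : Fin n) := contDiff_logWeight τ k
  have hlc (τ : Equiv.Perm (Fin n)) (k : Fin n) := (hl τ k).continuous
  have hF (τ : Equiv.Perm (Fin n)) (ε : Fin n → Bool) :=
    contDiff_chartFactor μ b τ (hψ τ ε)
  have hms : MeasurableSet (orthant n) := isOpen_orthant.measurableSet
  have heq (τ : Equiv.Perm (Fin n)) (ε : Fin n → Bool) (z : ℂ × ℂ) :
      Set.EqOn (fun w => (∏ i, chart τ ε w i) •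
        (radialWeight μ a b c z (chart τ ε w) * h (chart τ ε w)))
        (laplaceKernel (rate a τ ε) (weightRate a) (logWeight τ) (rateConst μ b c τ ε)
          (chartFactor μ b τ (ψ τ ε)) z) (orthant n) := by
    intro w hw
    simp only
    rw [hψe τ ε w hw, radialWeight_chart]
  have key (z : ℂ × ℂ) (hz : z ∈ domainD μ a b c) := integral_orthant_eq_sum
    (f := fun x => radialWeight μ a b c z x * h x) (fun τ ε => by
      refine IntegrableOn.congr_fun ?_ (heq τ ε z).symm hms
      have := integrable_laplaceKernel (rate a τ ε) (weightRate a) Finset.univ (hlc τ)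
        (hF τ ε).continuous (domainD_subset_laplaceDomain ha τ ε hz)
      rwa [faceMeasure_univ] at this)
  let J : Equiv.Perm (Fin n) × (Fin n → Bool) → ℂ × ℂ → ℂ := fun x =>
    laplaceInt (rate a x.1 x.2) (weightRate a) (logWeight x.1) Finset.univ
      (rateConst μ b c x.1 x.2) (chartFactor μ b x.1 (ψ x.1 x.2))
  have hval (z : ℂ × ℂ) (hz : z ∈ domainD μ a b c) :
      ∫ x in orthant n, radialWeight μ a b c z x * h x = ∑ x, J x z := by
    rw [(key z hz).2]
    refine Finset.sum_congr rfl fun x _ => ?_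
    simp only [J, laplaceInt, faceMeasure_univ]
    exact setIntegral_congr_fun hms (heq x.1 x.2 z)
  refine ⟨fun z hz => (key z hz).1, fun z hz => ?_, ?_⟩
  · have h1 : AnalyticAt ℂ (fun z => ∑ x, J x z) z :=
      Finset.analyticAt_fun_sum _ fun x _ => analyticAt_laplaceInt _ _ _ (hlc x.1)
        (hF x.1 x.2).continuous (domainD_subset_laplaceDomain ha x.1 x.2 hz)
    refine h1.congr ?_
    filter_upwards [(isOpen_domainD μ a b c).mem_nhds hz] with y hy
    exact (hval y hy).symm
  -- Allowing the depth `k` in all charts and directions at once gives open convex, hence connected,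
  -- sets that exhaust the plane.
  · let U : ℕ → Set (ℂ × ℂ) := fun k => ⋂ x : Equiv.Perm (Fin n) × (Fin n → Bool),
      laplaceDomain (rate a x.1 x.2) (rateConst μ b c x.1 x.2) fun _ => k
    refine exists_isMeromorphic (U := U) (isOpen_domainD μ a b c)
      (fun k => isOpen_iInter_of_finite fun x => isOpen_laplaceDomain _ _ _)
      (fun k => (convex_iInter fun x => convex_laplaceDomain _ _ _).isPreconnected) ?_ ?_ ?_ ?_
    · intro k m hkm
      refine Set.iInter_mono fun x z hz j => (hz j).trans_le' ?_
      simpa using hkm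
    · intro z
      let A : Equiv.Perm (Fin n) × (Fin n → Bool) → Fin n → ℝ := fun x j =>
        -(rate a x.1 x.2 j z + rateConst μ b c x.1 x.2 j).re
      obtain ⟨k, hk⟩ := exists_nat_gt (∑ x, ∑ j, |A x j|)
      refine ⟨k, Set.mem_iInter.2 fun x j => ?_⟩
      have h1 : |A x j| ≤ ∑ x, ∑ j, |A x j| :=
        (Finset.single_le_sum (f := fun j => |A x j|) (fun j _ => abs_nonneg _)
          (Finset.mem_univ j)).trans
        (Finset.single_le_sum (f := fun x => ∑ j, |A x j|)
          (fun x _ => Finset.sum_nonneg fun j _ => abs_nonneg _) (Finset.mem_univ x))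
      have h2 := le_abs_self (A x j)
      simp only [A] at h1 h2
      linarith
    · intro k z hz
      refine Set.mem_iInter.2 fun x j => ?_
      refine (domainD_subset_laplaceDomain ha x.1 x.2 hz j).trans_le' ?_
      simp
    · intro k
      refine HasContinuation.congr (HasContinuation.sum Finset.univ fun x => ?_) hval
      exact (hasContinuation_laplaceInt _ _ (fun i => rate_ne_zero ha x.1 x.2 i) (hl x.1)
        (fun _ => k) _ _ (hF x.1 x.2)).mono (domainD_subset_laplaceDomain ha x.1 x.2)
        (Set.iInter_subset _ x)

end Radial

/-! ### One-parameter groups and the Iwasawa decomposition in an `sl(2)`-triple -/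

section MatrixExp

open scoped Matrix.Norms.Operator

variable {ι : Type*} [Fintype ι] [DecidableEq ι]

theorem hasDerivAt_exp_comp (X : Matrix ι ι ℝ) {u : ℝ → ℝ} {u' t : ℝ} (hu : HasDerivAt u u' t) :
    HasDerivAt (fun t => NormedSpace.exp (u t • X)) (u' • (NormedSpace.exp (u t • X) * X)) t :=
  (hasDerivAt_exp_smul_const X (u t)).scomp t hu

theorem exp_smul_mul_comm (X : Matrix ι ι ℝ) (t : ℝ) :
    NormedSpace.exp (t • X) * X = X * NormedSpace.exp (t • X) :=
  (((Commute.refl X).smul_left t).exp_left).eq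

theorem exp_neg_smul_mul (X : Matrix ι ι ℝ) (t : ℝ) :
    NormedSpace.exp ((-t) • X) * NormedSpace.exp (t • X) = 1 := by
  rw [← Matrix.exp_add_of_commute _ _ (((Commute.refl X).smul_left _).smul_right _), ← add_smul]
  simp

theorem exp_smul_mul_neg (X : Matrix ι ι ℝ) (t : ℝ) :
    NormedSpace.exp (t • X) * NormedSpace.exp ((-t) • X) = 1 := by
  simpa using exp_neg_smul_mul X (-t)

theorem eq_of_hasDerivAt_zero {κ : Type*} [Fintype κ] {f : ℝ → Matrix κ κ ℝ} (hf : ∀ t, HasDerivAt f 0 t) (t : ℝ) :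
    f t = f 0 :=
  is_const_of_deriv_eq_zero (fun t => (hf t).differentiableAt) (fun t => (hf t).deriv) t 0

/-- A solution of `X' = [J, X]` is given by conjugation with `exp(tJ)`. -/
theorem exp_mul_eq_of_hasDerivAt (J : Matrix ι ι ℝ) {X : ℝ → Matrix ι ι ℝ}
    (hX : ∀ t, HasDerivAt X (J * X t - X t * J) t) (t : ℝ) :
    NormedSpace.exp (t • J) * X 0 = X t * NormedSpace.exp (t • J) := by
  have h := eq_of_hasDerivAt_zero
    (f := fun t => NormedSpace.exp ((-t) • J) * X t * NormedSpace.exp (t • J)) (fun t => by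
      have h1 := hasDerivAt_exp_comp J (hasDerivAt_neg t)
      have h2 := hasDerivAt_exp_comp J (hasDerivAt_id t)
      convert! (h1.mul (hX t)).mul h2 using 1
      simp only [id, one_smul, Pi.mul_apply]
      rw [exp_smul_mul_comm J t]
      generalize NormedSpace.exp ((-t) • J) = A
      generalize NormedSpace.exp (t • J) = B
      rw [neg_one_smul]
      noncomm_ring) t
  simp only [neg_zero, zero_smul, NormedSpace.exp_zero, one_mul, mul_one] at h
  rw [← h, ← mul_assoc, ← mul_assoc, exp_smul_mul_neg, one_mul]

/-- A solution of `X' = F X` with `X(0) = 1` is `exp(tF)`. -/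
theorem eq_exp_of_hasDerivAt (F : Matrix ι ι ℝ) {X : ℝ → Matrix ι ι ℝ}
    (hX : ∀ t, HasDerivAt X (F * X t) t) (h0 : X 0 = 1) (t : ℝ) :
    X t = NormedSpace.exp (t • F) := by
  have h := eq_of_hasDerivAt_zero
    (f := fun t => NormedSpace.exp ((-t) • F) * X t) (fun t => by
      have h1 := hasDerivAt_exp_comp F (hasDerivAt_neg t)
      convert! h1.mul (hX t) using 1
      rw [neg_one_smul]
      noncomm_ring) t
  simp only [neg_zero, zero_smul, NormedSpace.exp_zero, one_mul, h0] at h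
  rw [← mul_one (NormedSpace.exp (t • F)), ← h, ← mul_assoc, exp_smul_mul_neg, one_mul]

/-- The Iwasawa decomposition of `exp(yF)` for an `sl(2)`-triple. -/
theorem exp_smul_F_eq {E F H : Matrix ι ι ℝ} (hEF : E * F - F * E = H)
    (hHE : H * E - E * H = (2 : ℝ) • E) (hHF : H * F - F * H = (-2 : ℝ) • F) (y : ℝ) :
    NormedSpace.exp (y • F) = NormedSpace.exp (Real.arctan y • (F - E)) *
      NormedSpace.exp ((Real.log (1 + y ^ 2) / 2) • H) *
      NormedSpace.exp ((y / (1 + y ^ 2)) • E) := by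
  set J := F - E with hJ
  set P := E + F with hP
  -- With `J = F - E` and `P = E + F`, the operator `ad J` acts on the plane of `H` and `P` as an
  -- infinitesimal rotation of speed `2`. Hence conjugation by `exp (θ J)` rotates this plane by
  -- `2θ`.
  have hJH : J * H - H * J = (2 : ℝ) • P := by
    have : J * H - H * J = (H * E - E * H) - (H * F - F * H) := by rw [hJ]; noncomm_ring
    rw [this, hHE, hHF, hP]
    module
  have hJP : J * P - P * J = (-2 : ℝ) • H := by
    have : J * P - P * J = (-2 : ℝ) • (E * F - F * E) := by
      rw [hJ, hP]
      simp only [neg_smul, two_smul]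
      noncomm_ring
    rw [this, hEF]
  have hKH (θ : ℝ) : NormedSpace.exp (θ • J) * H =
      (Real.cos (2 * θ) • H + Real.sin (2 * θ) • P) * NormedSpace.exp (θ • J) := by
    have := exp_mul_eq_of_hasDerivAt J
      (X := fun θ => Real.cos (2 * θ) • H + Real.sin (2 * θ) • P) (fun θ => by
        have h2 : HasDerivAt (fun θ : ℝ => 2 * θ) 2 θ := by
          simpa using (hasDerivAt_id θ).const_mul 2
        convert! (h2.cos.smul_const H).add (h2.sin.smul_const P) using 1
        have : J * (Real.cos (2 * θ) • H + Real.sin (2 * θ) • P) -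
            (Real.cos (2 * θ) • H + Real.sin (2 * θ) • P) * J =
            Real.cos (2 * θ) • (J * H - H * J) + Real.sin (2 * θ) • (J * P - P * J) := by
          simp only [mul_add, add_mul, mul_smul_comm, smul_mul_assoc, smul_sub]
          abel
        rw [this, hJH, hJP]
        module) θ
    simpa using this
  have hKP (θ : ℝ) : NormedSpace.exp (θ • J) * P =
      (Real.cos (2 * θ) • P - Real.sin (2 * θ) • H) * NormedSpace.exp (θ • J) := by
    have := exp_mul_eq_of_hasDerivAt J
      (X := fun θ => Real.cos (2 * θ) • P - Real.sin (2 * θ) • H) (fun θ => by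
        have h2 : HasDerivAt (fun θ : ℝ => 2 * θ) 2 θ := by
          simpa using (hasDerivAt_id θ).const_mul 2
        convert! (h2.cos.smul_const P).sub (h2.sin.smul_const H) using 1
        have : J * (Real.cos (2 * θ) • P - Real.sin (2 * θ) • H) -
            (Real.cos (2 * θ) • P - Real.sin (2 * θ) • H) * J =
            Real.cos (2 * θ) • (J * P - P * J) - Real.sin (2 * θ) • (J * H - H * J) := by
          simp only [mul_sub, sub_mul, mul_smul_comm, smul_mul_assoc, smul_sub]
          abel
        rw [this, hJH, hJP]
        module) θ
    simpa using this
  have hKE (θ : ℝ) : NormedSpace.exp (θ • J) * E =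
      ((1 / 2 : ℝ) • (Real.cos (2 * θ) • P - Real.sin (2 * θ) • H - J)) *
        NormedSpace.exp (θ • J) := by
    have hE : E = (1 / 2 : ℝ) • (P - J) := by rw [hP, hJ]; module
    conv_lhs => rw [hE]
    rw [mul_smul_comm, mul_sub, hKP, exp_smul_mul_comm, smul_mul_assoc, sub_mul _ J]
  have hAE (h : ℝ) : NormedSpace.exp (h • H) * E =
      (Real.exp (2 * h) • E) * NormedSpace.exp (h • H) := by
    have := exp_mul_eq_of_hasDerivAt H (X := fun h => Real.exp (2 * h) • E) (fun h => by
        have h2 : HasDerivAt (fun h : ℝ => 2 * h) 2 h := by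
          simpa using (hasDerivAt_id h).const_mul 2
        convert! h2.exp.smul_const E using 1
        rw [mul_smul_comm, smul_mul_assoc, ← smul_sub, hHE]
        module) h
    simpa using this
  symm
  -- The product is shown to solve `X' = F X`, `X(0) = 1`. Moving all generators to the left reduces
  -- this to `F = θ' J + h' Ad(e^{θJ}) H + ν' e^{2h} Ad(e^{θJ}) E` with `θ = arctan y`, `h = log(1 +
  -- y²)/2` and `ν = y/(1 + y²)`.
  refine eq_exp_of_hasDerivAt F (X := fun y => NormedSpace.exp (Real.arctan y • J) *
      NormedSpace.exp ((Real.log (1 + y ^ 2) / 2) • H) *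
      NormedSpace.exp ((y / (1 + y ^ 2)) • E)) (fun y => ?_) (by simp) y
  have hy : (0 : ℝ) < 1 + y ^ 2 := by positivity
  have hsq : HasDerivAt (fun y : ℝ => 1 + y ^ 2) (2 * y) y := by
    simpa using (hasDerivAt_pow 2 y).const_add 1
  have d1 := hasDerivAt_exp_comp J (Real.hasDerivAt_arctan y)
  have d2 := hasDerivAt_exp_comp H ((hsq.log hy.ne').div_const 2)
  have d3 := hasDerivAt_exp_comp E ((hasDerivAt_id y).div hsq hy.ne')
  convert! (d1.mul d2).mul d3 using 1
  simp only [id, Pi.div_apply, Pi.mul_apply]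
  set K := NormedSpace.exp (Real.arctan y • J) with hK
  have h2h : Real.exp (2 * (Real.log (1 + y ^ 2) / 2)) = 1 + y ^ 2 := by
    rw [mul_div_cancel₀ _ two_ne_zero, Real.exp_log hy]
  have hAE' := hAE (Real.log (1 + y ^ 2) / 2)
  rw [h2h] at hAE'
  set A := NormedSpace.exp ((Real.log (1 + y ^ 2) / 2) • H) with hA
  set B := NormedSpace.exp ((y / (1 + y ^ 2)) • E) with hB
  have hcos : Real.cos (2 * Real.arctan y) = (1 - y ^ 2) / (1 + y ^ 2) := by
    rw [Real.cos_two_mul, Real.cos_sq_arctan]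
    field_simp
    ring
  have hsin : Real.sin (2 * Real.arctan y) = 2 * y / (1 + y ^ 2) := by
    rw [Real.sin_two_mul, Real.sin_arctan, Real.cos_arctan]
    field_simp
    rw [Real.sq_sqrt hy.le]
  have hKH' := hKH (Real.arctan y)
  have hKE' := hKE (Real.arctan y)
  rw [hcos, hsin, ← hK] at hKH' hKE'
  have c1 : K * J = J * K := exp_smul_mul_comm J _
  have c2 : A * H = H * A := exp_smul_mul_comm H _
  have c3 : B * E = E * B := exp_smul_mul_comm E _
  have hF : F = (1 / 2 : ℝ) • (J + P) := by rw [hP, hJ]; module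
  have e1 : K * (A * H) * B = ((((1 - y ^ 2) / (1 + y ^ 2)) • H + (2 * y / (1 + y ^ 2)) • P) * K)
      * A * B := by
    rw [c2, ← hKH']
    noncomm_ring
  have e2 : K * A * (B * E) = (1 + y ^ 2) • (((1 / 2 : ℝ) • (((1 - y ^ 2) / (1 + y ^ 2)) • P -
      (2 * y / (1 + y ^ 2)) • H - J)) * K) * A * B := by
    rw [c3, ← hKE', mul_assoc K A, ← mul_assoc A E, hAE']
    simp only [smul_mul_assoc, mul_smul_comm, mul_assoc]
  have lhs : F * (K * A * B) = ((1 / 2 : ℝ) • (J + P)) * (K * A * B) := by rw [← hF]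
  rw [lhs]
  simp only [add_mul _ _ B, smul_mul_assoc _ _ B, smul_mul_assoc _ _ A, mul_smul_comm]
  rw [c1, e1, e2]
  simp only [smul_mul_assoc, add_mul, sub_mul, smul_add, smul_sub, smul_smul, mul_assoc]
  -- Comparison of the coefficients of `J`, `H` and `P`, each multiplied by the group element; on
  -- the left `F = (J + P)/2`.
  match_scalars
  all_goals field_simp
  all_goals ring

end MatrixExp

/-! ### The Lie algebra of a closed matrix group -/

section LieSet

open scoped Matrix.Norms.Operator

variable {ι : Type*} [Fintype ι] [DecidableEq ι]

@[simp]
theorem coe_expGL (X : Matrix ι ι ℝ) : (expGL X : Matrix ι ι ℝ) = NormedSpace.exp X :=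
  IsUnit.unit_spec _

@[simp]
theorem coe_expGL_inv (X : Matrix ι ι ℝ) :
    ((expGL X)⁻¹ : GL ι ℝ) = expGL (-X) := by
  apply inv_eq_of_mul_eq_one_right
  ext1
  simp only [Units.val_mul, coe_expGL, Units.val_one]
  simpa using exp_smul_mul_neg X 1

theorem expGL_add_of_commute {X Y : Matrix ι ι ℝ} (h : Commute X Y) :
    expGL (X + Y) = expGL X * expGL Y := by
  ext1
  simp [Matrix.exp_add_of_commute _ _ h]

theorem expGL_zero : expGL (0 : Matrix ι ι ℝ) = 1 := by
  ext1
  simp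

/-- The powers `γ(1/k)^k` of a curve with `γ(0) = 1` and `γ'(0) = Z` converge to `exp Z`. -/
theorem tendsto_pow_exp {γ : ℝ → Matrix ι ι ℝ} {Z : Matrix ι ι ℝ} (h0 : γ 0 = 1)
    (hγ : HasDerivAt γ Z 0) :
    Tendsto (fun k : ℕ => γ (k : ℝ)⁻¹ ^ k) atTop (𝓝 (NormedSpace.exp Z)) := by
  -- A local inverse `lg` of `exp` gives `γ(1/k)^k = exp (k • lg (γ(1/k)))` for large `k`. The
  -- exponent tends to `Z` because `lg` has derivative the identity at `1`.
  have hexp : HasStrictFDerivAt (NormedSpace.exp : Matrix ι ι ℝ → Matrix ι ι ℝ)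
      ((ContinuousLinearEquiv.refl ℝ (Matrix ι ι ℝ) : Matrix ι ι ℝ ≃L[ℝ] Matrix ι ι ℝ) :
        Matrix ι ι ℝ →L[ℝ] Matrix ι ι ℝ) 0 :=
    hasStrictFDerivAt_exp_zero (𝕂 := ℝ)
  let lg := hexp.localInverse _ _ _
  have e0 : NormedSpace.exp (0 : Matrix ι ι ℝ) = 1 := NormedSpace.exp_zero
  have hlg : HasFDerivAt lg (ContinuousLinearMap.id ℝ (Matrix ι ι ℝ)) (γ 0) := by
    have := hexp.to_localInverse.hasFDerivAt
    rw [e0, ← h0] at this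
    exact this
  have hlg0 : lg 1 = 0 := by
    have := hexp.localInverse_apply_image
    rwa [e0] at this
  have hinv : ∀ᶠ X in 𝓝 (1 : Matrix ι ι ℝ), NormedSpace.exp (lg X) = X := by
    have := hexp.eventually_right_inverse
    rwa [e0] at this
  have hd : HasDerivAt (fun t => lg (γ t)) Z 0 := by
    exact hlg.comp_hasDerivAt (0 : ℝ) hγ
  have hk : Tendsto (fun k : ℕ => (k : ℝ)⁻¹) atTop (𝓝[≠] 0) := by
    refine tendsto_nhdsWithin_iff.2 ⟨tendsto_inv_atTop_nhds_zero_nat, ?_⟩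
    filter_upwards [eventually_gt_atTop 0] with k hk
    simpa using hk.ne'
  have h1 : Tendsto (fun k : ℕ => (k : ℝ) • lg (γ (k : ℝ)⁻¹)) atTop (𝓝 Z) := by
    have := hd.tendsto_slope_zero.comp hk
    refine this.congr fun k => ?_
    simp [h0, hlg0]
  have h2 := ((NormedSpace.exp_continuous (𝔸 := Matrix ι ι ℝ)).tendsto Z).comp h1
  refine h2.congr' ?_
  have h3 : Tendsto (fun k : ℕ => γ (k : ℝ)⁻¹) atTop (𝓝 1) := by
    rw [← h0]
    exact hγ.continuousAt.tendsto.comp (hk.mono_right nhdsWithin_le_nhds)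
  filter_upwards [h3.eventually hinv] with k hk
  rw [Function.comp_apply, Nat.cast_smul_eq_nsmul]
  exact (Matrix.exp_nsmul k _).trans (by rw [hk])

theorem expGL_mem_of_hasDerivAt {G : Subgroup (GL ι ℝ)} (hG : IsClosed (G : Set (GL ι ℝ)))
    {γ : ℝ → GL ι ℝ} (hγG : ∀ t, γ t ∈ G) (h0 : γ 0 = 1) {Z : Matrix ι ι ℝ}
    (hγ : HasDerivAt (fun t => (γ t : Matrix ι ι ℝ)) Z 0) : expGL Z ∈ G := by
  have h := tendsto_pow_exp (γ := fun t => (γ t : Matrix ι ι ℝ)) (by simp [h0]) hγ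
  have h2 : Tendsto (fun k : ℕ => γ (k : ℝ)⁻¹ ^ k) atTop (𝓝 (expGL Z)) := by
    refine (Units.isOpenEmbedding_val (R := Matrix ι ι ℝ)).isEmbedding.tendsto_nhds_iff.2 ?_
    simp only [Function.comp_def, Units.val_pow_eq_pow_val, coe_expGL]
    exact h
  exact hG.mem_of_tendsto h2 (.of_forall fun k => G.pow_mem (hγG _) k)

theorem smul_mem_lieSet {S : Set (GL ι ℝ)} {X : Matrix ι ι ℝ} (hX : X ∈ lieSet S) (t : ℝ) :
    t • X ∈ lieSet S := fun s => by
  rw [smul_smul]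
  exact hX _

theorem expGL_mem {S : Set (GL ι ℝ)} {X : Matrix ι ι ℝ} (hX : X ∈ lieSet S) : expGL X ∈ S := by
  simpa using hX 1

variable {G : Subgroup (GL ι ℝ)}

/-- The curve `exp(tsX) exp(tsY)` in `G` has derivative `s(X + Y)` at `0`, so the limit of its
powers is the required exponential. -/
theorem add_mem_lieSet (hG : IsClosed (G : Set (GL ι ℝ))) {X Y : Matrix ι ι ℝ}
    (hX : X ∈ lieSet (G : Set (GL ι ℝ))) (hY : Y ∈ lieSet (G : Set (GL ι ℝ))) :
    X + Y ∈ lieSet (G : Set (GL ι ℝ)) := by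
  intro s
  have h1 := hasDerivAt_exp_comp (s • X) (hasDerivAt_id (0 : ℝ))
  have h2 := hasDerivAt_exp_comp (s • Y) (hasDerivAt_id (0 : ℝ))
  refine expGL_mem_of_hasDerivAt hG (γ := fun t => expGL (t • s • X) * expGL (t • s • Y))
    (fun t => G.mul_mem (smul_mem_lieSet hX s t) (smul_mem_lieSet hY s t)) ?_ ?_
  · simp [expGL_zero]
  · simp only [Units.val_mul, coe_expGL]
    convert! h1.mul h2 using 1
    simp

theorem conj_mem_lieSet {g : GL ι ℝ} (hg : g ∈ G) {X : Matrix ι ι ℝ}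
    (hX : X ∈ lieSet (G : Set (GL ι ℝ))) :
    (g : Matrix ι ι ℝ) * X * ((g⁻¹ : GL ι ℝ) : Matrix ι ι ℝ) ∈ lieSet (G : Set (GL ι ℝ)) := by
  intro t
  have : expGL (t • ((g : Matrix ι ι ℝ) * X * ((g⁻¹ : GL ι ℝ) : Matrix ι ι ℝ))) =
      g * expGL (t • X) * g⁻¹ := by
    ext1
    rw [coe_expGL, Units.val_mul, Units.val_mul, coe_expGL, ← Matrix.exp_units_conj]
    simp only [mul_smul_comm, smul_mul_assoc]
  rw [this]
  exact G.mul_mem (G.mul_mem hg (hX t)) (G.inv_mem hg)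

/-- The Lie algebra of a closed subgroup as a linear subspace. -/
def lieSubmodule (hG : IsClosed (G : Set (GL ι ℝ))) : Submodule ℝ (Matrix ι ι ℝ) where
  carrier := lieSet (G : Set (GL ι ℝ))
  add_mem' := add_mem_lieSet hG
  zero_mem' t := by
    rw [smul_zero, expGL_zero]
    exact G.one_mem
  smul_mem' t _ hX := smul_mem_lieSet hX t

theorem mem_lieSubmodule {hG : IsClosed (G : Set (GL ι ℝ))} {X : Matrix ι ι ℝ} :
    X ∈ lieSubmodule hG ↔ X ∈ lieSet (G : Set (GL ι ℝ)) := Iff.rfl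

/-- The bracket is the derivative at `0` of `Ad(exp tX) Y`. The difference quotients lie in the Lie
algebra, a finite-dimensional and hence closed subspace. -/
theorem lie_mem_lieSet (hG : IsClosed (G : Set (GL ι ℝ))) {X Y : Matrix ι ι ℝ}
    (hX : X ∈ lieSet (G : Set (GL ι ℝ))) (hY : Y ∈ lieSet (G : Set (GL ι ℝ))) :
    ⁅X, Y⁆ ∈ lieSet (G : Set (GL ι ℝ)) := by
  have h1 := hasDerivAt_exp_comp X (hasDerivAt_id (0 : ℝ))
  have h2 := hasDerivAt_exp_comp X (hasDerivAt_neg (0 : ℝ))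
  have h3 : HasDerivAt (fun t : ℝ => NormedSpace.exp (t • X) * Y * NormedSpace.exp ((-t) • X))
      ⁅X, Y⁆ 0 := by
    convert! (h1.mul_const Y).mul h2 using 1
    simp [Ring.lie_def, sub_eq_add_neg]
  have hclosed : IsClosed (lieSubmodule hG : Set (Matrix ι ι ℝ)) :=
    (lieSubmodule hG).closed_of_finiteDimensional
  refine hclosed.mem_of_tendsto h3.tendsto_slope_zero (.of_forall fun t => ?_)
  refine (lieSubmodule hG).smul_mem _ ((lieSubmodule hG).sub_mem ?_ ?_)
  swap
  · simpa [mem_lieSubmodule] using hY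
  have := conj_mem_lieSet (hX t) hY
  rw [coe_expGL_inv, coe_expGL, coe_expGL, ← neg_smul] at this
  simpa [mem_lieSubmodule] using this

end LieSet

/-! ### Brackets and joint eigenspaces of commuting symmetric matrices -/

section Bracket

variable {κ : Type*} [Fintype κ] (X Y Z : Matrix κ κ ℝ) (t : ℝ)

theorem bracket_zero : ⁅X, (0 : Matrix κ κ ℝ)⁆ = 0 := by simp [Ring.lie_def]

theorem bracket_add : ⁅X, Y + Z⁆ = ⁅X, Y⁆ + ⁅X, Z⁆ := by
  simp only [Ring.lie_def, mul_add, add_mul]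
  abel

theorem bracket_smul : ⁅X, t • Y⁆ = t • ⁅X, Y⁆ := by
  simp only [Ring.lie_def, mul_smul_comm, smul_mul_assoc, smul_sub]

theorem smul_bracket : ⁅t • X, Y⁆ = t • ⁅X, Y⁆ := by
  simp only [Ring.lie_def, mul_smul_comm, smul_mul_assoc, smul_sub]

theorem bracket_bracket : ⁅X, ⁅Y, Z⁆⁆ = ⁅⁅X, Y⁆, Z⁆ + ⁅Y, ⁅X, Z⁆⁆ := by
  simp only [Ring.lie_def, mul_sub, sub_mul, mul_assoc]
  abel

end Bracket

section JointEigen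

variable {ι : Type*} [Fintype ι] [DecidableEq ι]

/-- The simultaneous eigenvectors `X` with `[S_k, X] = χ_k X` for all `k`. -/
def jointEigenspace {κ : Type*} (S : κ → Matrix ι ι ℝ) (χ : κ → ℝ) :
    Submodule ℝ (Matrix ι ι ℝ) where
  carrier := {X | ∀ k, ⁅S k, X⁆ = χ k • X}
  add_mem' hX hY k := by rw [bracket_add, hX, hY, smul_add]
  zero_mem' k := by rw [bracket_zero, smul_zero]
  smul_mem' t X hX k := by rw [bracket_smul, hX, smul_comm]

open Module.End in
/-- A subspace that is invariant under the adjoint action of commuting symmetric matrices is the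
direct sum of its joint eigenspaces. -/
theorem jointEigenspace_decomposition {κ : Type*} {S : κ → Matrix ι ι ℝ} (hS : ∀ k, (S k)ᵀ = S k)
    (hcomm : ∀ j k, Commute (S j) (S k)) {W : Submodule ℝ (Matrix ι ι ℝ)}
    (hW : ∀ k, ∀ X ∈ W, ⁅S k, X⁆ ∈ W) :
    iSupIndep (fun χ : κ → ℝ => (jointEigenspace S χ).comap W.subtype) ∧
      ⨆ χ : κ → ℝ, (jointEigenspace S χ).comap W.subtype = ⊤ := by
  -- For the trace inner product, bracketing with a symmetric matrix is a symmetric operator, so the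
  -- spectral theorem for commuting symmetric operators applies.
  let _ : NormedAddCommGroup (Matrix ι ι ℝ) := Matrix.toMatrixNormedAddCommGroup 1 PosDef.one
  let _ : InnerProductSpace ℝ (Matrix ι ι ℝ) :=
    Matrix.toMatrixInnerProductSpace 1 PosDef.one.posSemidef
  have hinner (X Y : Matrix ι ι ℝ) : inner ℝ X Y = (Y * Xᵀ).trace := by
    change (Y * 1 * Xᴴ).trace = _
    rw [mul_one, Matrix.conjTranspose_eq_transpose_of_trivial]
  let A : κ → Matrix ι ι ℝ →ₗ[ℝ] Matrix ι ι ℝ := fun k =>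
    LinearMap.mulLeft ℝ (S k) - LinearMap.mulRight ℝ (S k)
  have hA (k : κ) (X : Matrix ι ι ℝ) : A k X = ⁅S k, X⁆ := rfl
  have hsym (k : κ) : (A k).IsSymmetric := by
    intro X Y
    rw [hinner, hinner, hA, hA, Ring.lie_def, Ring.lie_def, Matrix.transpose_sub,
      Matrix.transpose_mul, Matrix.transpose_mul, hS, mul_sub, sub_mul, Matrix.trace_sub,
      Matrix.trace_sub, mul_assoc (S k) Y, Matrix.trace_mul_comm (S k), mul_assoc, mul_assoc]
  have hAW (k : κ) : ∀ X ∈ W, A k X ∈ W := hW k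
  let T : κ → W →ₗ[ℝ] W := fun k => (A k).restrict (hAW k)
  have hT (k : κ) : (T k).IsSymmetric := (hsym k).restrict_invariant (hAW k)
  have hTc : Pairwise (Function.onFun Commute T) := by
    intro j k _
    refine LinearMap.ext fun X => Subtype.ext ?_
    change ⁅S j, ⁅S k, (X : Matrix ι ι ℝ)⁆⁆ = ⁅S k, ⁅S j, (X : Matrix ι ι ℝ)⁆⁆
    have : ⁅S j, S k⁆ = 0 := sub_eq_zero.2 (hcomm j k).eq
    rw [bracket_bracket, this]
    simp [Ring.lie_def]
  have heq (χ : κ → ℝ) : ⨅ k, eigenspace (T k) (χ k) =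
      (jointEigenspace S χ).comap W.subtype := by
    ext X
    rw [Submodule.mem_iInf, Submodule.mem_comap]
    refine forall_congr' fun k => ?_
    rw [mem_eigenspace_iff, Subtype.ext_iff]
    rfl
  constructor
  · have := (LinearMap.IsSymmetric.orthogonalFamily_iInf_eigenspaces hT).independent
    simpa only [heq] using this
  · have := LinearMap.IsSymmetric.iSup_iInf_eq_top_of_commute hT hTc
    simpa only [heq] using this

theorem le_of_jointEigenspace_inf_le {κ : Type*} {S : κ → Matrix ι ι ℝ} (hS : ∀ k, (S k)ᵀ = S k)
    (hcomm : ∀ j k, Commute (S j) (S k)) {W W' : Submodule ℝ (Matrix ι ι ℝ)}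
    (hW : ∀ k, ∀ X ∈ W, ⁅S k, X⁆ ∈ W)
    (h : ∀ χ : κ → ℝ, ∀ X ∈ W, (∀ k, ⁅S k, X⁆ = χ k • X) → X ∈ W') : W ≤ W' := by
  have hle : (⨆ χ : κ → ℝ, (jointEigenspace S χ).comap W.subtype) ≤ W'.comap W.subtype :=
    iSup_le fun χ X hX => h χ X X.2 hX
  rw [(jointEigenspace_decomposition hS hcomm hW).2] at hle
  exact fun X hX => hle (x := ⟨X, hX⟩) trivial

/-- Conjugation by an orthogonal matrix has determinant `±1` on each invariant subspace. -/
theorem abs_det_eq_one_of_orthogonal {W : Submodule ℝ (Matrix ι ι ℝ)} {k k' : Matrix ι ι ℝ}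
    (hk : kᵀ * k = 1) (hk' : k' * k'ᵀ = 1) (T : W →ₗ[ℝ] W)
    (hT : ∀ Y : W, (T Y : Matrix ι ι ℝ) = k * Y * k') : |LinearMap.det T| = 1 := by
  let _ : NormedAddCommGroup (Matrix ι ι ℝ) := Matrix.toMatrixNormedAddCommGroup 1 PosDef.one
  let _ : InnerProductSpace ℝ (Matrix ι ι ℝ) :=
    Matrix.toMatrixInnerProductSpace 1 PosDef.one.posSemidef
  have hinner (X Y : Matrix ι ι ℝ) : inner ℝ X Y = (Y * Xᵀ).trace := by
    change (Y * 1 * Xᴴ).trace = _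
    rw [mul_one, Matrix.conjTranspose_eq_transpose_of_trivial]
  let U : W →ₗᵢ[ℝ] W := T.isometryOfInner fun X Y => by
    rw [Submodule.coe_inner, Submodule.coe_inner, hinner, hinner, hT, hT, Matrix.transpose_mul,
      Matrix.transpose_mul, mul_assoc (k * _), ← mul_assoc k', hk', one_mul, mul_assoc,
      Matrix.trace_mul_comm k, mul_assoc, mul_assoc, hk, mul_one]
  have := U.normDet_eq_one
  rwa [LinearMap.normDet_eq_abs_det] at this

end JointEigen

/-! ### The grading of `𝔤` by `∑ H_j` -/

section Admissible

variable {ι : Type*} [Fintype ι] [DecidableEq ι] {n : ℕ} {G : Subgroup (GL ι ℝ)}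
  {E : Fin n → Matrix ι ι ℝ} {d : ℝ} {e : ℕ}

theorem transpose_H {κ : Type*} [Fintype κ] (E : Fin n → Matrix κ κ ℝ) (j : Fin n) :
    (H E j)ᵀ = H E j := by
  simp [H, F, Ring.lie_def, Matrix.transpose_sub, Matrix.transpose_mul]

/-- The sum of the `H_j`, which spans `𝔞`. -/
def sumH {κ : Type*} [Fintype κ] (E : Fin n → Matrix κ κ ℝ) : Matrix κ κ ℝ := ∑ j, H E j

theorem transpose_sumH {κ : Type*} [Fintype κ] (E : Fin n → Matrix κ κ ℝ) : (sumH E)ᵀ = sumH E := by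
  simp [sumH, Matrix.transpose_sum, transpose_H]

theorem theta_expGL (X : Matrix ι ι ℝ) : theta (expGL X) = expGL (-Xᵀ) := by
  ext1
  change (((expGL X)⁻¹ : GL ι ℝ) : Matrix ι ι ℝ)ᵀ = _
  rw [coe_expGL_inv, coe_expGL, coe_expGL, ← Matrix.exp_transpose, Matrix.transpose_neg]

namespace IsAdmissible

theorem F_mem (hG : IsAdmissible G E d e) (j : Fin n) : F E j ∈ lieSet (G : Set (GL ι ℝ)) := by
  intro t
  have := hG.theta_mem _ (hG.E_mem j (-t))
  rw [theta_expGL] at this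
  simpa [F] using this

theorem H_mem (hG : IsAdmissible G E d e) (j : Fin n) : H E j ∈ lieSet (G : Set (GL ι ℝ)) :=
  lie_mem_lieSet hG.isClosed (hG.E_mem j) (hG.F_mem j)

theorem commute_E_E (hG : IsAdmissible G E d e) (j k : Fin n) : Commute (E j) (E k) := by
  rcases eq_or_ne j k with rfl | h
  · exact Commute.refl _
  · exact sub_eq_zero.1 (hG.E_comm_E j k h)

theorem commute_E_F (hG : IsAdmissible G E d e) {j k : Fin n} (h : j ≠ k) :
    Commute (E j) (F E k) :=
  sub_eq_zero.1 (hG.E_comm_F j k h)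

theorem commute_F_F (hG : IsAdmissible G E d e) (j k : Fin n) : Commute (F E j) (F E k) := by
  have := congrArg Matrix.transpose (hG.commute_E_E j k).eq
  rw [Matrix.transpose_mul, Matrix.transpose_mul] at this
  exact this.symm

theorem commute_H_E (hG : IsAdmissible G E d e) {j k : Fin n} (h : j ≠ k) :
    Commute (H E j) (E k) := by
  have h1 := hG.commute_E_E j k
  have h2 := (hG.commute_E_F h.symm).symm
  rw [H, Ring.lie_def]
  exact (h1.mul_left h2).sub_left (h2.mul_left h1)

theorem commute_H_F (hG : IsAdmissible G E d e) {j k : Fin n} (h : j ≠ k) :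
    Commute (H E j) (F E k) := by
  have h1 := hG.commute_E_F h
  have h2 := hG.commute_F_F j k
  rw [H, Ring.lie_def]
  exact (h1.mul_left h2).sub_left (h2.mul_left h1)

theorem commute_H_H (hG : IsAdmissible G E d e) (j k : Fin n) : Commute (H E j) (H E k) := by
  rcases eq_or_ne j k with rfl | h
  · exact Commute.refl _
  · have h1 := hG.commute_H_E h
    have h2 := hG.commute_H_F h
    conv_rhs => rw [H, Ring.lie_def]
    exact (h1.mul_right h2).sub_right (h2.mul_right h1)

theorem commute_H_sumH (hG : IsAdmissible G E d e) (j : Fin n) : Commute (H E j) (sumH E) :=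
  Commute.sum_right _ _ _ fun k _ => hG.commute_H_H j k

theorem mem_rootSpace (hG : IsAdmissible G E d e) {r : Fin n → ℝ} {X : Matrix ι ι ℝ} :
    X ∈ rootSpace G E r ↔ X ∈ lieSet (G : Set (GL ι ℝ)) ∧ ∀ k, ⁅H E k, X⁆ = r k • X := by
  refine ⟨fun h => ?_, fun h => Submodule.subset_span h⟩
  induction h using Submodule.span_induction with
  | mem X h => exact h
  | zero => exact ⟨(lieSubmodule hG.isClosed).zero_mem, by simp [bracket_zero]⟩
  | add X Y _ _ hX hY =>
    exact ⟨add_mem_lieSet hG.isClosed hX.1 hY.1, fun k => by rw [bracket_add, hX.2, hY.2, smul_add]⟩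
  | smul t X _ hX =>
    exact ⟨smul_mem_lieSet hX.1 t, fun k => by rw [bracket_smul, hX.2, smul_comm]⟩

theorem mem_nilrad_of_weight {j k : Fin n} {X : Matrix ι ι ℝ}
    (h : X ∈ rootSpace G E (eps j + eps k)) : X ∈ nilrad G E :=
  Submodule.mem_iSup_of_mem j (Submodule.mem_iSup_of_mem k h)

theorem sumH_lie {κ : Type*} [Fintype κ] (E : Fin n → Matrix κ κ ℝ) (X : Matrix κ κ ℝ) :
    ⁅sumH E, X⁆ = ∑ j, ⁅H E j, X⁆ := by
  simp only [sumH, Ring.lie_def, Finset.sum_mul, Finset.mul_sum, Finset.sum_sub_distrib]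

theorem sum_eps (j : Fin n) : ∑ k, eps j k = 1 := by simp [eps]

/-- The elements of `𝔤` with eigenvalue `c` under the adjoint action of `∑ H_j`. -/
def gradedPart (hG : IsAdmissible G E d e) (c : ℝ) : Submodule ℝ (Matrix ι ι ℝ) where
  carrier := {X | X ∈ lieSet (G : Set (GL ι ℝ)) ∧ ⁅sumH E, X⁆ = c • X}
  add_mem' hX hY := ⟨add_mem_lieSet hG.isClosed hX.1 hY.1, by rw [bracket_add, hX.2, hY.2, smul_add]⟩
  zero_mem' := ⟨(lieSubmodule hG.isClosed).zero_mem, by simp [bracket_zero]⟩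
  smul_mem' t X hX := ⟨smul_mem_lieSet hX.1 t, by rw [bracket_smul, hX.2, smul_comm]⟩

theorem mem_gradedPart {hG : IsAdmissible G E d e} {c : ℝ} {X : Matrix ι ι ℝ} :
    X ∈ hG.gradedPart c ↔ X ∈ lieSet (G : Set (GL ι ℝ)) ∧ ⁅sumH E, X⁆ = c • X := Iff.rfl

/-- The graded part is stable under every `ad H_k`, so it is spanned by its joint eigenvectors. The
coordinates of each weight that occurs add up to `c`. -/
theorem gradedPart_le (hG : IsAdmissible G E d e) {c : ℝ} {W : Submodule ℝ (Matrix ι ι ℝ)}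
    (h : ∀ χ : Fin n → ℝ, ∑ k, χ k = c → rootSpace G E χ ≤ W) : hG.gradedPart c ≤ W := by
  refine le_of_jointEigenspace_inf_le (transpose_H E) hG.commute_H_H (fun k X hX => ?_)
    fun χ X hX hχ => ?_
  · refine ⟨lie_mem_lieSet hG.isClosed (hG.H_mem k) hX.1, ?_⟩
    have hc : ⁅sumH E, H E k⁆ = 0 := sub_eq_zero.2 (hG.commute_H_sumH k).symm.eq
    rw [bracket_bracket, hc, hX.2, bracket_smul]
    simp [Ring.lie_def]
  · rcases eq_or_ne X 0 with rfl | h0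
    · exact W.zero_mem
    · refine h χ ?_ (hG.mem_rootSpace.2 ⟨hX.1, hχ⟩)
      have := hX.2
      rw [sumH_lie, Finset.sum_congr rfl fun k _ => hχ k, ← Finset.sum_smul] at this
      exact smul_left_injective ℝ h0 this

/-- The coordinate sum of a root is `0`, `2` or `-2`, and it is `2` exactly for the roots `ε_j +
ε_k`. This replaces the sum of root spaces by a single eigenvalue equation, which is easy to test.
-/
theorem mem_nilrad (hG : IsAdmissible G E d e) {X : Matrix ι ι ℝ} :
    X ∈ nilrad G E ↔ X ∈ lieSet (G : Set (GL ι ℝ)) ∧ ⁅sumH E, X⁆ = (2 : ℝ) • X := by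
  rw [← mem_gradedPart (hG := hG)]
  refine ⟨fun h => ?_, fun h => ?_⟩
  · have : nilrad G E ≤ hG.gradedPart 2 := by
      refine iSup_le fun j => iSup_le fun k X hX => ?_
      obtain ⟨h1, h2⟩ := hG.mem_rootSpace.1 hX
      refine ⟨h1, ?_⟩
      rw [sumH_lie, Finset.sum_congr rfl fun k _ => h2 k, ← Finset.sum_smul]
      simp only [Pi.add_apply, Finset.sum_add_distrib, sum_eps]
      norm_num
    exact this h
  · refine hG.gradedPart_le (fun χ hχ => ?_) h
    by_cases hbot : rootSpace G E χ = ⊥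
    · simp [hbot]
    · have hχ0 : χ ≠ 0 := by
        rintro rfl
        simp at hχ
      rcases (hG.roots χ hχ0).1 hbot with ⟨j, k, -, rfl⟩ | ⟨j, k, rfl | rfl⟩
      · simp [Finset.sum_sub_distrib, sum_eps] at hχ
      · exact fun X hX => mem_nilrad_of_weight hX
      · simp only [Pi.neg_apply, Pi.add_apply, Finset.sum_neg_distrib, Finset.sum_add_distrib,
          sum_eps] at hχ
        norm_num at hχ

/-- The bracket has degree `2 + 2 = 4`, and no root has coordinate sum `4`. -/
theorem commute_of_mem_nilrad (hG : IsAdmissible G E d e) {X Y : Matrix ι ι ℝ}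
    (hX : X ∈ nilrad G E) (hY : Y ∈ nilrad G E) : Commute X Y := by
  rw [hG.mem_nilrad] at hX hY
  have h1 : ⁅X, Y⁆ ∈ hG.gradedPart 4 := by
    refine ⟨lie_mem_lieSet hG.isClosed hX.1 hY.1, ?_⟩
    rw [bracket_bracket, hX.2, hY.2, smul_bracket, bracket_smul, ← add_smul]
    norm_num
  have h2 : hG.gradedPart 4 ≤ ⊥ := by
    refine hG.gradedPart_le fun χ hχ => le_of_eq ?_
    by_contra hbot
    have hχ0 : χ ≠ 0 := by
      rintro rfl
      simp at hχ
    rcases (hG.roots χ hχ0).1 hbot with ⟨j, k, -, rfl⟩ | ⟨j, k, rfl | rfl⟩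
    · simp [Finset.sum_sub_distrib, sum_eps] at hχ
    · simp only [Pi.add_apply, Finset.sum_add_distrib, sum_eps] at hχ
      norm_num at hχ
    · simp only [Pi.neg_apply, Pi.add_apply, Finset.sum_neg_distrib, Finset.sum_add_distrib,
        sum_eps] at hχ
      norm_num at hχ
  exact sub_eq_zero.1 (h2 h1)

end IsAdmissible

end Admissible

/-- The determinant of an endomorphism that is a scalar on each summand of a decomposition. -/
theorem det_eq_prod_of_isInternal {V α : Type*} [AddCommGroup V] [Module ℝ V]
    [FiniteDimensional ℝ V] [Fintype α] [DecidableEq α] {N : α → Submodule ℝ V}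
    (hN : DirectSum.IsInternal N) (T : V →ₗ[ℝ] V) (c : α → ℝ)
    (hT : ∀ i, ∀ v ∈ N i, T v = c i • v) :
    LinearMap.det T = ∏ i, c i ^ Module.finrank ℝ (N i) := by
  classical
  let b := hN.collectedBasis fun i => Module.finBasis ℝ (N i)
  have hb (p : Σ i, Fin (Module.finrank ℝ (N i))) : T (b p) = c p.1 • b p :=
    hT _ _ (hN.collectedBasis_mem _ p)
  have hdiag : LinearMap.toMatrix b b T = Matrix.diagonal fun p => c p.1 := by
    ext p q
    rw [LinearMap.toMatrix_apply, hb, map_smul, b.repr_self, Matrix.diagonal_apply]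
    by_cases hpq : p = q
    · simp [hpq]
    · simp [hpq]
  rw [← LinearMap.det_toMatrix b, hdiag, Matrix.det_diagonal, Fintype.prod_sigma]
  simp

/-! ### The determinant of the adjoint action on `𝔫` -/

section Admissible

variable {ι : Type*} [Fintype ι] [DecidableEq ι] {n : ℕ} {G : Subgroup (GL ι ℝ)}
  {E : Fin n → Matrix ι ι ℝ} {d : ℝ} {e : ℕ}

theorem exp_mul_eq_smul {S X : Matrix ι ι ℝ} {c : ℝ} (h : ⁅S, X⁆ = c • X) :
    NormedSpace.exp S * X = Real.exp c • (X * NormedSpace.exp S) := by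
  open scoped Matrix.Norms.Operator in
  have := exp_mul_eq_of_hasDerivAt S (X := fun t => Real.exp (t * c) • X) (fun t => by
    have h2 : HasDerivAt (fun t : ℝ => t * c) c t := by
      simpa using (hasDerivAt_id t).mul_const c
    convert! h2.exp.smul_const X using 1
    rw [mul_smul_comm, smul_mul_assoc, ← smul_sub]
    change _ • ⁅S, X⁆ = _
    rw [h, smul_smul]) 1
  simpa using this

/-- The space `𝔞` is spanned by `∑ H_j`. -/
theorem mem_groupL_iff {g : GL ι ℝ} :
    g ∈ groupL G E ↔ g ∈ G ∧ Commute (g : Matrix ι ι ℝ) (sumH E) := by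
  have hX (X : Matrix ι ι ℝ) : X ∈ lieA E ↔ ∃ t : ℝ, X = t • sumH E := by
    constructor
    · rintro ⟨h, hh, rfl⟩
      rcases isEmpty_or_nonempty (Fin n) with hn | ⟨⟨i⟩⟩
      · exact ⟨0, by simp⟩
      · refine ⟨h i, ?_⟩
        rw [sumH, Finset.smul_sum]
        exact Finset.sum_congr rfl fun j _ => by rw [hh j i]
    · rintro ⟨t, rfl⟩
      exact ⟨fun _ => t, fun _ _ => rfl, by rw [sumH, Finset.smul_sum]⟩
  refine and_congr_right fun _ => ⟨fun h => ?_, fun h X hXm => ?_⟩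
  · exact h _ ((hX _).2 ⟨1, by simp⟩)
  · obtain ⟨t, rfl⟩ := (hX X).1 hXm
    exact (h.smul_right t).eq

namespace IsAdmissible

theorem conj_mem_nilrad (hG : IsAdmissible G E d e) {g : GL ι ℝ} (hg : g ∈ G)
    (hgc : Commute (g : Matrix ι ι ℝ) (sumH E)) {Y : Matrix ι ι ℝ} (hY : Y ∈ nilrad G E) :
    (g : Matrix ι ι ℝ) * Y * ((g⁻¹ : GL ι ℝ) : Matrix ι ι ℝ) ∈ nilrad G E := by
  rw [hG.mem_nilrad] at hY ⊢
  refine ⟨conj_mem_lieSet hg hY.1, ?_⟩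
  have h2 : Commute ((g⁻¹ : GL ι ℝ) : Matrix ι ι ℝ) (sumH E) := hgc.units_inv_left
  have h3 : (g : Matrix ι ι ℝ) * (⁅sumH E, Y⁆) * ((g⁻¹ : GL ι ℝ) : Matrix ι ι ℝ) =
      ⁅sumH E, (g : Matrix ι ι ℝ) * Y * ((g⁻¹ : GL ι ℝ) : Matrix ι ι ℝ)⁆ := by
    rw [Ring.lie_def, Ring.lie_def, mul_sub, sub_mul, ← mul_assoc (sumH E), ← mul_assoc (sumH E),
      ← hgc.eq, mul_assoc _ _ (sumH E), h2.eq]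
    simp only [mul_assoc]
  rw [← h3, hY.2, mul_smul_comm, smul_mul_assoc]

/-- The adjoint action on `𝔫` of an element of `G` that commutes with `∑ H_j`. -/
def conjNilrad (hG : IsAdmissible G E d e) {g : GL ι ℝ} (hg : g ∈ G)
    (hgc : Commute (g : Matrix ι ι ℝ) (sumH E)) : nilrad G E →ₗ[ℝ] nilrad G E :=
  (LinearMap.mulRight ℝ ((g⁻¹ : GL ι ℝ) : Matrix ι ι ℝ) ∘ₗ
    LinearMap.mulLeft ℝ (g : Matrix ι ι ℝ)).restrict fun _ hY => hG.conj_mem_nilrad hg hgc hY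

theorem coe_conjNilrad (hG : IsAdmissible G E d e) {g : GL ι ℝ} (hg : g ∈ G)
    (hgc : Commute (g : Matrix ι ι ℝ) (sumH E)) (Y : nilrad G E) :
    (hG.conjNilrad hg hgc Y : Matrix ι ι ℝ) =
      (g : Matrix ι ι ℝ) * Y * ((g⁻¹ : GL ι ℝ) : Matrix ι ι ℝ) := rfl

theorem eps_comp (j : Fin n) (σ : Equiv.Perm (Fin n)) : eps j ∘ σ = eps (σ.symm j) := by
  ext i
  simp only [eps, Function.comp_apply, Pi.single_apply]
  congr 1
  rw [eq_iff_iff, Equiv.eq_symm_apply]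

/-- The multiplicity of `χ` in `𝔫`. -/
def nilMult (G : Subgroup (GL ι ℝ)) (E : Fin n → Matrix ι ι ℝ) (χ : Fin n → ℝ) : ℕ :=
  Module.finrank ℝ ((jointEigenspace (H E) χ).comap (nilrad G E).subtype)

theorem exists_of_nilrad_weight (hG : IsAdmissible G E d e) {χ : Fin n → ℝ}
    (h : (jointEigenspace (H E) χ).comap (nilrad G E).subtype ≠ ⊥) :
    ∃ j k, χ = eps j + eps k := by
  obtain ⟨X, hX, hX0⟩ := Submodule.exists_mem_ne_zero_of_ne_bot h
  have hX0' : (X : Matrix ι ι ℝ) ≠ 0 := fun h => hX0 (Subtype.ext h)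
  have h1 := hG.mem_nilrad.1 X.2
  have h2 : (X : Matrix ι ι ℝ) ∈ rootSpace G E χ := hG.mem_rootSpace.2 ⟨h1.1, hX⟩
  have hsum : ∑ k, χ k = 2 := by
    have := h1.2
    have hXk (k : Fin n) : ⁅H E k, (X : Matrix ι ι ℝ)⁆ = χ k • (X : Matrix ι ι ℝ) := hX k
    rw [sumH_lie, Finset.sum_congr rfl fun k _ => hXk k, ← Finset.sum_smul] at this
    exact smul_left_injective ℝ hX0' this
  have hbot : rootSpace G E χ ≠ ⊥ := fun hb => hX0' (by rw [hb] at h2; exact h2)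
  have hχ0 : χ ≠ 0 := by
    rintro rfl
    simp at hsum
  rcases (hG.roots χ hχ0).1 hbot with ⟨j, k, -, rfl⟩ | ⟨j, k, rfl | rfl⟩
  · simp [Finset.sum_sub_distrib, sum_eps] at hsum
  · exact ⟨j, k, rfl⟩
  · simp only [Pi.neg_apply, Pi.add_apply, Finset.sum_neg_distrib, Finset.sum_add_distrib,
      sum_eps] at hsum
    norm_num at hsum

theorem nilMult_eps_add (hG : IsAdmissible G E d e) (j k : Fin n) :
    nilMult G E (eps j + eps k) = Module.finrank ℝ (rootSpace G E (eps j + eps k)) := by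
  have hle : rootSpace G E (eps j + eps k) ≤ nilrad G E := fun X hX => mem_nilrad_of_weight hX
  have : (jointEigenspace (H E) (eps j + eps k)).comap (nilrad G E).subtype =
      (rootSpace G E (eps j + eps k)).comap (nilrad G E).subtype := by
    ext X
    rw [Submodule.mem_comap, Submodule.mem_comap, hG.mem_rootSpace]
    exact ⟨fun h => ⟨(hG.mem_nilrad.1 X.2).1, h⟩, fun h => h.2⟩
  rw [nilMult, this]
  exact (Submodule.comapSubtypeEquivOfLe hle).finrank_eq

/-- The weights of `𝔫` are the `ε_j + ε_k`. Permuting coordinates preserves the distinction `j = k`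
versus `j ≠ k`, on which alone the multiplicity depends. -/
theorem nilMult_comp (hG : IsAdmissible G E d e) (χ : Fin n → ℝ) (σ : Equiv.Perm (Fin n)) :
    nilMult G E (χ ∘ σ) = nilMult G E χ := by
  have key (χ : Fin n → ℝ) (σ : Equiv.Perm (Fin n))
      (h : (jointEigenspace (H E) χ).comap (nilrad G E).subtype ≠ ⊥) :
      nilMult G E (χ ∘ σ) = nilMult G E χ := by
    obtain ⟨j, k, rfl⟩ := hG.exists_of_nilrad_weight h
    have : (eps j + eps k) ∘ σ = eps (σ.symm j) + eps (σ.symm k) := by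
      rw [← eps_comp, ← eps_comp]
      rfl
    rw [this, hG.nilMult_eps_add, hG.nilMult_eps_add]
    rcases eq_or_ne j k with rfl | hjk
    · rw [hG.long_mult, hG.long_mult]
    · have h1 := hG.short_mult j k hjk
      have h2 := hG.short_mult (σ.symm j) (σ.symm k) (by simpa using hjk)
      exact_mod_cast h2.trans h1.symm
  by_cases h : (jointEigenspace (H E) χ).comap (nilrad G E).subtype = ⊥
  · by_cases h' : (jointEigenspace (H E) (χ ∘ σ)).comap (nilrad G E).subtype = ⊥
    · rw [nilMult, nilMult, h, h', finrank_bot]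
    · have := key _ σ.symm h'
      rw [Function.comp_assoc, Equiv.self_comp_symm, Function.comp_id] at this
      exact this.symm
  · exact key χ σ h

/-- The sum of the weights of `𝔫` is proportional to `∑ ε_k`. -/
theorem finsum_nilMult_eq (hG : IsAdmissible G E d e) (i j : Fin n) :
    ∑ᶠ χ : Fin n → ℝ, (nilMult G E χ : ℝ) * χ i = ∑ᶠ χ : Fin n → ℝ, (nilMult G E χ : ℝ) * χ j := by
  -- Reindexing the weights by this transposition preserves multiplicities and exchanges the two
  -- coordinates.
  let σ := Equiv.swap i j
  have h := finsum_comp_equiv (σ.arrowCongr (Equiv.refl ℝ))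
    (f := fun χ : Fin n → ℝ => (nilMult G E χ : ℝ) * χ j)
  rw [← h]
  refine finsum_congr fun χ => ?_
  have h1 : (σ.arrowCongr (Equiv.refl ℝ)) χ = χ ∘ σ.symm := rfl
  rw [h1, hG.nilMult_comp]
  simp [σ]

theorem sum_smul_H_mem (hG : IsAdmissible G E d e) (s : Fin n → ℝ) :
    ∑ k, s k • H E k ∈ lieSet (G : Set (GL ι ℝ)) :=
  (lieSubmodule hG.isClosed).sum_mem fun k _ => smul_mem_lieSet (hG.H_mem k) (s k)

theorem commute_exp_sum_smul_H (hG : IsAdmissible G E d e) (s : Fin n → ℝ) :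
    Commute (expGL (∑ k, s k • H E k) : Matrix ι ι ℝ) (sumH E) := by
  rw [coe_expGL]
  exact (Commute.sum_left _ _ _ fun k _ => (hG.commute_H_sumH k).smul_left (s k)).exp_left

theorem nilrad_bracket_H (hG : IsAdmissible G E d e) (k : Fin n) {X : Matrix ι ι ℝ}
    (hX : X ∈ nilrad G E) : ⁅H E k, X⁆ ∈ nilrad G E := by
  rw [hG.mem_nilrad] at hX ⊢
  refine ⟨lie_mem_lieSet hG.isClosed (hG.H_mem k) hX.1, ?_⟩
  have hc : ⁅sumH E, H E k⁆ = 0 := sub_eq_zero.2 (hG.commute_H_sumH k).symm.eq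
  rw [bracket_bracket, hc, hX.2, bracket_smul]
  simp [Ring.lie_def]

/-- The determinant on `𝔫` is the exponential of the sum of all weights evaluated at `s`. By
`finsum_nilMult_eq` that sum is a multiple of `∑ s_k = 0`. -/
theorem exp_sum_smul_H_mem_groupM (hG : IsAdmissible G E d e) {s : Fin n → ℝ}
    (hs : ∑ k, s k = 0) : expGL (∑ k, s k • H E k) ∈ groupM G E := by
  classical
  have hg := expGL_mem (hG.sum_smul_H_mem s)
  have hgc := hG.commute_exp_sum_smul_H s
  refine ⟨mem_groupL_iff.2 ⟨hg, hgc⟩, hG.conjNilrad hg hgc,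
    hG.coe_conjNilrad hg hgc, ?_⟩
  let N : (Fin n → ℝ) → Submodule ℝ (nilrad G E) := fun χ =>
    (jointEigenspace (H E) χ).comap (nilrad G E).subtype
  obtain ⟨hind, htop⟩ := jointEigenspace_decomposition (transpose_H E) hG.commute_H_H
    (W := nilrad G E) fun k X hX => hG.nilrad_bracket_H k hX
  have hint : DirectSum.IsInternal N :=
    DirectSum.isInternal_submodule_iff_iSupIndep_and_iSup_eq_top N |>.2 ⟨hind, htop⟩
  -- Only finitely many weight spaces are nonzero; discarding the others gives the finite index set
  -- needed for the determinant.
  have hint' := DirectSum.isInternal_ne_bot_iff.2 hint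
  have hfin : {χ | N χ ≠ ⊥}.Finite := WellFoundedGT.finite_ne_bot_of_iSupIndep hind
  let _ : Fintype {χ // N χ ≠ ⊥} := hfin.fintype
  rw [det_eq_prod_of_isInternal hint' _ (fun χ => Real.exp (∑ k, s k * χ.1 k)) ?_]
  · have h1 : ∏ χ : {χ // N χ ≠ ⊥}, Real.exp (∑ k, s k * χ.1 k) ^ Module.finrank ℝ (N χ.1) =
        Real.exp (∑ k, s k * ∑ᶠ χ : Fin n → ℝ, (nilMult G E χ : ℝ) * χ k) := by
      simp only [← Real.exp_nat_mul]
      rw [← Real.exp_sum]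
      congr 1
      have h2 (k : Fin n) : ∑ᶠ χ : Fin n → ℝ, (nilMult G E χ : ℝ) * χ k =
          ∑ χ : {χ // N χ ≠ ⊥}, (nilMult G E χ.1 : ℝ) * χ.1 k := by
        rw [finsum_eq_sum_of_support_subset (s := hfin.toFinset)]
        · exact (Finset.sum_subtype _ (fun χ => by simp) _)
        · intro χ hχ
          simp only [Set.Finite.coe_toFinset]
          intro hb
          refine hχ ?_
          have : nilMult G E χ = 0 := by
            change Module.finrank ℝ (N χ) = 0
            rw [hb, finrank_bot]
          simp [this]
      simp only [h2, Finset.mul_sum]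
      rw [Finset.sum_comm]
      refine Finset.sum_congr rfl fun k _ => Finset.sum_congr rfl fun χ _ => ?_
      rw [nilMult]
      ring
    rw [h1]
    rcases isEmpty_or_nonempty (Fin n) with hn | ⟨⟨i⟩⟩
    · simp
    · rw [Finset.sum_congr rfl fun k _ => by rw [hG.finsum_nilMult_eq k i], ← Finset.sum_mul, hs]
      simp
  · rintro ⟨χ, hχ⟩ X hX
    refine Subtype.ext ?_
    rw [hG.coe_conjNilrad, coe_expGL_inv, coe_expGL, coe_expGL]
    have h1 : ⁅∑ k, s k • H E k, (X : Matrix ι ι ℝ)⁆ = (∑ k, s k * χ k) • (X : Matrix ι ι ℝ) := by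
      have : ⁅∑ k, s k • H E k, (X : Matrix ι ι ℝ)⁆ = ∑ k, s k • ⁅H E k, (X : Matrix ι ι ℝ)⁆ := by
        simp only [Ring.lie_def, Finset.sum_mul, Finset.mul_sum, smul_sub,
          Finset.sum_sub_distrib, smul_mul_assoc, mul_smul_comm]
      rw [this, Finset.sum_smul]
      refine Finset.sum_congr rfl fun k _ => ?_
      have hXk : ⁅H E k, (X : Matrix ι ι ℝ)⁆ = χ k • (X : Matrix ι ι ℝ) := hX k
      rw [hXk, smul_smul]
    rw [exp_mul_eq_smul h1, smul_mul_assoc, mul_assoc]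
    have := exp_smul_mul_neg (∑ k, s k • H E k) 1
    simp only [one_smul, neg_smul] at this
    rw [this, mul_one]
    rfl

end IsAdmissible

end Admissible

/-! ### The `K`-component of `exp(∑ y_j F_j)` -/

section Iwasawa

variable {ι : Type*} [Fintype ι] [DecidableEq ι] {n : ℕ} {G : Subgroup (GL ι ℝ)}
  {E : Fin n → Matrix ι ι ℝ} {d : ℝ} {e : ℕ}

theorem mem_maxCompact {g : GL ι ℝ} : g ∈ maxCompact G ↔ g ∈ G ∧ theta g = g := Iff.rfl

theorem coe_inv_of_mem_maxCompact {g : GL ι ℝ} (hg : g ∈ maxCompact G) :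
    ((g⁻¹ : GL ι ℝ) : Matrix ι ι ℝ) = (g : Matrix ι ι ℝ)ᵀ := by
  have h := congrArg (fun g : GL ι ℝ => (g : Matrix ι ι ℝ)ᵀ) (mem_maxCompact.1 hg).2
  change (((g⁻¹ : GL ι ℝ) : Matrix ι ι ℝ)ᵀ)ᵀ = _ at h
  rwa [Matrix.transpose_transpose] at h

/-- Exponentials of elements of `𝔫` move `∑ H_j` by a translation. -/
theorem exp_mul_sumH {Y : Matrix ι ι ℝ} (hY : ⁅sumH E, Y⁆ = (2 : ℝ) • Y) :
    NormedSpace.exp Y * sumH E = (sumH E - (2 : ℝ) • Y) * NormedSpace.exp Y := by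
  open scoped Matrix.Norms.Operator in
  have := exp_mul_eq_of_hasDerivAt Y (X := fun t => sumH E - (2 * t) • Y) (fun t => by
    have h2 : HasDerivAt (fun t : ℝ => 2 * t) 2 t := by
      simpa using (hasDerivAt_id t).const_mul 2
    convert! (h2.smul_const Y).const_sub (sumH E) using 1
    rw [← hY, Ring.lie_def]
    simp only [mul_sub, sub_mul, mul_smul_comm, smul_mul_assoc]
    abel) 1
  simpa using this

namespace IsAdmissible

theorem commute_of_mem_groupA (hG : IsAdmissible G E d e) {a : GL ι ℝ} (ha : a ∈ groupA E) :
    a ∈ G ∧ Commute (a : Matrix ι ι ℝ) (sumH E) := by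
  obtain ⟨X, ⟨h, -, rfl⟩, rfl⟩ := ha
  exact ⟨expGL_mem (hG.sum_smul_H_mem h), hG.commute_exp_sum_smul_H h⟩

/-- The elements of `K` in the parabolic subgroup lie in `M`. -/
theorem mem_groupM_of_maxCompact (hG : IsAdmissible G E d e) {m l l' : GL ι ℝ}
    (hm : m ∈ maxCompact G) (hlG : l ∈ G) (hl : Commute (l : Matrix ι ι ℝ) (sumH E))
    (hl' : Commute (l' : Matrix ι ι ℝ) (sumH E)) {Y : Matrix ι ι ℝ} (hY : Y ∈ nilrad G E)
    (h : m * l' = l * expGL Y) : m ∈ groupM G E := by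
  have hminv := coe_inv_of_mem_maxCompact hm
  -- Since `l` and `l'` commute with `∑ H_j` while `exp Y` shifts it by `-2Y`, conjugation by `m`
  -- sends `∑ H_j` to `∑ H_j + Z`.
  set Z := (-2 : ℝ) • ((l : Matrix ι ι ℝ) * Y * ((l⁻¹ : GL ι ℝ) : Matrix ι ι ℝ)) with hZ
  have hZn : Z ∈ nilrad G E := (nilrad G E).smul_mem _ (hG.conj_mem_nilrad hlG hl hY)
  have h1 : (m : Matrix ι ι ℝ) * sumH E = (sumH E + Z) * (m : Matrix ι ι ℝ) := by
    have hv : (m : Matrix ι ι ℝ) * (l' : Matrix ι ι ℝ) = l * NormedSpace.exp Y := by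
      rw [← Units.val_mul, h, Units.val_mul, coe_expGL]
    have hu : (m : Matrix ι ι ℝ) * sumH E * l' = (sumH E + Z) * m * l' := by
      rw [mul_assoc, ← hl'.eq, ← mul_assoc, hv, mul_assoc (l : Matrix ι ι ℝ),
        exp_mul_sumH (hG.mem_nilrad.1 hY).2, mul_assoc (sumH E + Z), hv, add_mul, hZ]
      have e1 : (l : Matrix ι ι ℝ) * sumH E = sumH E * l := hl.eq
      have e2 : ((l⁻¹ : GL ι ℝ) : Matrix ι ι ℝ) * l = 1 := Units.inv_mul l
      simp only [sub_mul, mul_sub, smul_mul_assoc, mul_smul_comm, mul_assoc]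
      rw [← mul_assoc (l : Matrix ι ι ℝ) (sumH E), e1,
        ← mul_assoc ((l⁻¹ : GL ι ℝ) : Matrix ι ι ℝ) (l : Matrix ι ι ℝ) (NormedSpace.exp Y), e2,
        one_mul, neg_smul, sub_eq_add_neg, mul_assoc]
    have := congrArg (· * ((l'⁻¹ : GL ι ℝ) : Matrix ι ι ℝ)) hu
    simpa only [mul_assoc, Units.mul_inv, mul_one] using this
  have h2 : sumH E + Z = (m : Matrix ι ι ℝ) * sumH E * (m : Matrix ι ι ℝ)ᵀ := by
    rw [h1, mul_assoc, ← hminv, Units.mul_inv, mul_one]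
  clear_value Z
  -- As `m` is orthogonal, it conjugates the symmetric matrix `∑ H_j` to a symmetric one.
  have hZt : Zᵀ = Z := by
    have h3 := congrArg Matrix.transpose h2
    rw [Matrix.transpose_mul, Matrix.transpose_mul, Matrix.transpose_transpose, transpose_sumH,
      ← mul_assoc, ← h2, Matrix.transpose_add, transpose_sumH] at h3
    exact add_left_cancel h3
  -- For symmetric `Z`, transposing `[∑ H_j, Z] = 2Z` gives `-[∑ H_j, Z] = 2Z`; adding the two
  -- yields `4Z = 0`.
  have hZ0 : Z = 0 := by
    have h3 := (hG.mem_nilrad.1 hZn).2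
    have h4 := congrArg Matrix.transpose h3
    rw [Ring.lie_def, Matrix.transpose_sub, Matrix.transpose_mul, Matrix.transpose_mul,
      hZt, transpose_sumH, Matrix.transpose_smul, hZt] at h4
    rw [Ring.lie_def] at h3
    have h5 : (4 : ℝ) • Z = 0 := by
      have : (4 : ℝ) • Z = (2 : ℝ) • Z + (2 : ℝ) • Z := by module
      rw [this]
      nth_rewrite 1 [← h3]
      rw [← h4]
      abel
    exact (smul_eq_zero.1 h5).resolve_left (by norm_num)
  have hmc : Commute (m : Matrix ι ι ℝ) (sumH E) := by
    rw [hZ0, add_zero] at h1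
    exact h1
  have hmG := (mem_maxCompact.1 hm).1
  refine ⟨mem_groupL_iff.2 ⟨hmG, hmc⟩, hG.conjNilrad hmG hmc, hG.coe_conjNilrad hmG hmc, ?_⟩
  refine abs_det_eq_one_of_orthogonal ?_ ?_ _ (hG.coe_conjNilrad hmG hmc)
  · rw [← hminv, Units.inv_mul]
  · rw [hminv, Matrix.transpose_transpose, ← hminv, Units.inv_mul]

theorem commute_of_mem_lieMS {S : Matrix ι ι ℝ} (hS : S ∈ lieMS G E) :
    expGL S ∈ G ∧ Commute (expGL S : Matrix ι ι ℝ) (sumH E) :=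
  mem_groupL_iff.1 (expGL_mem hS.1).1

/-- The `K`-component is unique up to `K ∩ M`. -/
theorem inv_mul_mem_groupM (hG : IsAdmissible G E d e) {g : GL ι ℝ} {k k' : maxCompact G}
    (hk : IsKPart G E g k) (hk' : IsKPart G E g k') :
    ((k⁻¹ * k' : maxCompact G) : GL ι ℝ) ∈ groupM G E := by
  obtain ⟨S, hS, a, ha, y, ⟨Y, hY, rfl⟩, rfl⟩ := hk
  obtain ⟨S', hS', a', ha', y', ⟨Y', hY', rfl⟩, h⟩ := hk'
  have hSc := commute_of_mem_lieMS hS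
  have hac := hG.commute_of_mem_groupA ha
  have hSc' := commute_of_mem_lieMS hS'
  have hac' := hG.commute_of_mem_groupA ha'
  refine hG.mem_groupM_of_maxCompact (l := expGL S * a) (l' := expGL S' * a') (Y := Y - Y')
    (k⁻¹ * k').2 (G.mul_mem hSc.1 hac.1) ?_ ?_ ((nilrad G E).sub_mem hY hY') ?_
  · rw [Units.val_mul]
    exact hSc.2.mul_left hac.2
  · rw [Units.val_mul]
    exact hSc'.2.mul_left hac'.2
  -- Because `𝔫` is abelian, the two factors from `N` merge into one exponential.
  · have h1 : expGL (Y - Y') = expGL Y * (expGL Y')⁻¹ := by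
      rw [coe_expGL_inv, sub_eq_add_neg, expGL_add_of_commute]
      exact (hG.commute_of_mem_nilrad hY hY').neg_right
    rw [h1, ← mul_assoc (expGL S * a), eq_mul_inv_iff_mul_eq, Subgroup.coe_mul, Subgroup.coe_inv]
    simp only [mul_assoc] at h ⊢
    rw [← h, inv_mul_cancel_left]

/-- `kappa` picks an arbitrary admissible component. Its ambiguity lies in `K ∩ M`, so any explicit
component may be used under `φ`. -/
theorem apply_kappa_eq (hG : IsAdmissible G E d e) {φ : maxCompact G → ℂ}
    (hφ : ∀ k m : maxCompact G, (m : GL ι ℝ) ∈ groupM G E → φ (k * m) = φ k) {g : GL ι ℝ}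
    {k : maxCompact G} (hk : IsKPart G E g k) : φ (kappa G E g) = φ k := by
  have hex : ∃ k, IsKPart G E g k := ⟨k, hk⟩
  have h1 : kappa G E g = hex.choose := by rw [kappa, dif_pos hex]
  rw [h1, ← hφ k _ (hG.inv_mul_mem_groupM hk hex.choose_spec), mul_inv_cancel_left]

/-- The copies of `sl(2)` commute, so their individual decompositions can be multiplied and the
factors regrouped by type. -/
theorem exp_sum_smul_F (hG : IsAdmissible G E d e) (y : Fin n → ℝ) (s : Finset (Fin n)) :
    NormedSpace.exp (∑ j ∈ s, y j • F E j) =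
      NormedSpace.exp (∑ j ∈ s, Real.arctan (y j) • (F E j - E j)) *
      NormedSpace.exp (∑ j ∈ s, (Real.log (1 + y j ^ 2) / 2) • H E j) *
      NormedSpace.exp (∑ j ∈ s, (y j / (1 + y j ^ 2)) • E j) := by
  induction s using Finset.cons_induction with
  | empty => simp
  | cons i s hi ih =>
    have hne : ∀ j ∈ s, i ≠ j := fun j hj h => hi (h ▸ hj)
    have cE (j : Fin n) (hj : j ∈ s) : Commute (F E i - E i) (E j) :=
      ((hG.commute_E_F (hne j hj).symm).symm).sub_left (hG.commute_E_E i j)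
    have cF (j : Fin n) (hj : j ∈ s) : Commute (F E i - E i) (F E j) :=
      (hG.commute_F_F i j).sub_left (hG.commute_E_F (hne j hj))
    have c1 : Commute (Real.arctan (y i) • (F E i - E i))
        (∑ j ∈ s, Real.arctan (y j) • (F E j - E j)) :=
      Commute.sum_right _ _ _ fun j hj =>
        (((cF j hj).sub_right (cE j hj)).smul_left _).smul_right _
    have c2 : Commute ((Real.log (1 + y i ^ 2) / 2) • H E i)
        (∑ j ∈ s, (Real.log (1 + y j ^ 2) / 2) • H E j) :=
      Commute.sum_right _ _ _ fun j _ => ((hG.commute_H_H i j).smul_left _).smul_right _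
    have c3 : Commute ((y i / (1 + y i ^ 2)) • E i) (∑ j ∈ s, (y j / (1 + y j ^ 2)) • E j) :=
      Commute.sum_right _ _ _ fun j _ => ((hG.commute_E_E i j).smul_left _).smul_right _
    have c4 : Commute (y i • F E i) (∑ j ∈ s, y j • F E j) :=
      Commute.sum_right _ _ _ fun j _ => ((hG.commute_F_F i j).smul_left _).smul_right _
    have c5 : Commute (NormedSpace.exp ((Real.log (1 + y i ^ 2) / 2) • H E i))
        (NormedSpace.exp (∑ j ∈ s, Real.arctan (y j) • (F E j - E j))) :=
      (Commute.sum_right _ _ _ fun j hj => (((hG.commute_H_F (hne j hj)).sub_right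
        (hG.commute_H_E (hne j hj))).smul_left _).smul_right _).exp
    have c6 : Commute (NormedSpace.exp ((y i / (1 + y i ^ 2)) • E i))
        (NormedSpace.exp (∑ j ∈ s, Real.arctan (y j) • (F E j - E j))) :=
      (Commute.sum_right _ _ _ fun j hj => (((hG.commute_E_F (hne j hj)).sub_right
        (hG.commute_E_E i j)).smul_left _).smul_right _).exp
    have c7 : Commute (NormedSpace.exp ((y i / (1 + y i ^ 2)) • E i))
        (NormedSpace.exp (∑ j ∈ s, (Real.log (1 + y j ^ 2) / 2) • H E j)) :=
      (Commute.sum_right _ _ _ fun j hj => (((hG.commute_H_E (hne j hj).symm).symm).smul_left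
        _).smul_right _).exp
    simp only [Finset.sum_cons]
    rw [Matrix.exp_add_of_commute _ _ c1, Matrix.exp_add_of_commute _ _ c2,
      Matrix.exp_add_of_commute _ _ c3, Matrix.exp_add_of_commute _ _ c4, ih,
      exp_smul_F_eq (E := E i) (H := H E i) rfl (hG.H_E i) (hG.H_F i) (y i)]
    generalize NormedSpace.exp (Real.arctan (y i) • (F E i - E i)) = K₁
    generalize NormedSpace.exp ((Real.log (1 + y i ^ 2) / 2) • H E i) = A₁ at *
    generalize NormedSpace.exp ((y i / (1 + y i ^ 2)) • E i) = N₁ at *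
    generalize NormedSpace.exp (∑ j ∈ s, Real.arctan (y j) • (F E j - E j)) = K₂ at *
    generalize NormedSpace.exp (∑ j ∈ s, (Real.log (1 + y j ^ 2) / 2) • H E j) = A₂ at *
    generalize NormedSpace.exp (∑ j ∈ s, (y j / (1 + y j ^ 2)) • E j) = N₂
    calc K₁ * A₁ * N₁ * (K₂ * A₂ * N₂) = K₁ * A₁ * (N₁ * K₂) * A₂ * N₂ := by
          simp only [mul_assoc]
      _ = K₁ * (A₁ * K₂) * (N₁ * A₂) * N₂ := by rw [c6.eq]; simp only [mul_assoc]
      _ = K₁ * K₂ * (A₁ * A₂) * (N₁ * N₂) := by rw [c5.eq, c7.eq]; simp only [mul_assoc]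

/-- The element `exp(∑ θ_j (F_j - E_j))` of `K`. -/
def rotation (hG : IsAdmissible G E d e) (θ : Fin n → ℝ) : maxCompact G :=
  ⟨expGL (∑ j, θ j • (F E j - E j)), by
    constructor
    · exact expGL_mem ((lieSubmodule hG.isClosed).sum_mem fun j _ =>
        smul_mem_lieSet ((lieSubmodule hG.isClosed).sub_mem (hG.F_mem j) (hG.E_mem j)) _)
    · change theta _ = _
      rw [theta_expGL]
      congr 1
      simp only [Matrix.transpose_sum, Matrix.transpose_smul, Matrix.transpose_sub, F,
        Matrix.transpose_transpose]
      rw [← Finset.sum_neg_distrib]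
      exact Finset.sum_congr rfl fun j _ => by rw [← smul_neg, neg_sub]⟩

/-- In the product decomposition the factor `exp(∑ h_j H_j)` is split into the mean of the `h_j`,
which lies in `A`, and the deviations from it. These sum to zero and therefore lie in `exp(𝔪 ∩ 𝔰)`.
-/
theorem isKPart_rotation (hG : IsAdmissible G E d e) (y : Fin n → ℝ) :
    IsKPart G E (expGL (∑ j, y j • F E j)) (hG.rotation fun j => Real.arctan (y j)) := by
  set h : Fin n → ℝ := fun j => Real.log (1 + y j ^ 2) / 2
  set μ : ℝ := (∑ j, h j) / n
  have hsum : ∑ j, (h j - μ) = 0 := by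
    rcases Nat.eq_zero_or_pos n with rfl | hn
    · simp
    · have : (n : ℝ) ≠ 0 := by exact_mod_cast hn.ne'
      rw [Finset.sum_sub_distrib]
      simp only [Finset.sum_const, Finset.card_univ, Fintype.card_fin, nsmul_eq_mul, μ]
      field_simp
      ring
  refine ⟨∑ j, (h j - μ) • H E j, ⟨fun t => ?_, ?_⟩, expGL (∑ j, μ • H E j),
    ⟨_, ⟨fun _ => μ, fun _ _ => rfl, rfl⟩, rfl⟩, expGL (∑ j, (y j / (1 + y j ^ 2)) • E j),
    ⟨_, (nilrad G E).sum_mem fun j _ => (nilrad G E).smul_mem _ ?_, rfl⟩, ?_⟩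
  · have : t • ∑ j, (h j - μ) • H E j = ∑ j, (t * (h j - μ)) • H E j := by
      rw [Finset.smul_sum]
      exact Finset.sum_congr rfl fun j _ => smul_smul _ _ _
    rw [this]
    refine hG.exp_sum_smul_H_mem_groupM ?_
    rw [← Finset.mul_sum, hsum, mul_zero]
  · simp only [Matrix.transpose_sum, Matrix.transpose_smul, transpose_H]
  · refine mem_nilrad_of_weight (j := j) (k := j) (hG.mem_rootSpace.2 ⟨hG.E_mem j, fun k => ?_⟩)
    rcases eq_or_ne k j with rfl | hkj
    · rw [hG.H_E]
      simp only [eps, Pi.add_apply, Pi.single_eq_same]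
      norm_num
    · have : ⁅H E k, E j⁆ = 0 := sub_eq_zero.2 (hG.commute_H_E hkj).eq
      rw [this]
      simp [eps, hkj]
  · have hc : Commute (∑ j, (h j - μ) • H E j) (∑ j, μ • H E j) :=
      Commute.sum_left _ _ _ fun j _ => Commute.sum_right _ _ _ fun k _ =>
        ((hG.commute_H_H j k).smul_left _).smul_right _
    have hadd : ∑ j, (h j - μ) • H E j + ∑ j, μ • H E j = ∑ j, h j • H E j := by
      rw [← Finset.sum_add_distrib]
      exact Finset.sum_congr rfl fun j _ => by rw [← add_smul, sub_add_cancel]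
    rw [mul_assoc _ (expGL (∑ j, (h j - μ) • H E j)) (expGL (∑ j, μ • H E j)),
      ← expGL_add_of_commute hc, hadd]
    ext1
    simp only [Units.val_mul, coe_expGL, rotation]
    exact hG.exp_sum_smul_F y Finset.univ

theorem apply_kappaAt_eq (hG : IsAdmissible G E d e) {φ : maxCompact G → ℂ}
    (hφ : IsSmoothRightInvariant G E φ) (q : Fin n → Fin n) (x : Fin n → ℝ) :
    φ (kappaAt G E q x) = φ (hG.rotation fun j => Real.arctan (x (q j))) :=
  hG.apply_kappa_eq hφ.2 (hG.isKPart_rotation fun j => x (q j))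

end IsAdmissible

end Iwasawa

/-! ### Order, sign and arctangent in the charts -/

section Charts

variable {n : ℕ}

theorem signProd_congr {N : ℕ} {x y : Fin N → ℝ} (h : ∀ i j, x i < x j ↔ y i < y j) :
    signProd x = signProd y := by
  have h1 : SignType.sign (∏ i : Fin N, ∏ j ∈ Finset.Ioi i, (x i - x j)) =
      SignType.sign (∏ i : Fin N, ∏ j ∈ Finset.Ioi i, (y i - y j)) := by
    change signHom _ = signHom _
    simp only [map_prod]
    refine Finset.prod_congr rfl fun i _ => Finset.prod_congr rfl fun j _ => ?_
    simp only [signHom_apply, sign_apply, sub_pos, sub_neg, h]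
  have h2 : ∀ r : ℝ, Real.sign r = (SignType.sign r : ℝ) := fun r => by
    rcases lt_trichotomy r 0 with hr | rfl | hr
    · simp [Real.sign_of_neg hr, sign_neg hr]
    · simp
    · simp [Real.sign_of_pos hr, sign_pos hr]
  rw [signProd, signProd, h2, h2, h1]

theorem chainSum_pos (τ : Equiv.Perm (Fin n)) {w : Fin n → ℝ} (hw : w ∈ orthant n) (i : Fin n) :
    0 < chainSum τ w i :=
  Finset.sum_pos (fun k _ => hw k) ⟨τ.symm i, by simp⟩

theorem chainSum_lt_iff (τ : Equiv.Perm (Fin n)) {w : Fin n → ℝ} (hw : w ∈ orthant n)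
    (i j : Fin n) : chainSum τ w i < chainSum τ w j ↔ τ.symm i < τ.symm j :=
  (strictMono_sum_Iic hw).lt_iff_lt

/-- Coordinates with opposite signs lie on different sides of `1`, and those with equal signs are
ordered by `τ`. The comparison is thus independent of the point of the chart. -/
theorem chart_lt_iff (τ : Equiv.Perm (Fin n)) (ε : Fin n → Bool) {w w' : Fin n → ℝ}
    (hw : w ∈ orthant n) (hw' : w' ∈ orthant n) (i j : Fin n) :
    chart τ ε w i < chart τ ε w j ↔ chart τ ε w' i < chart τ ε w' j := by
  have hi := chainSum_pos τ hw i
  have hj := chainSum_pos τ hw j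
  have hi' := chainSum_pos τ hw' i
  have hj' := chainSum_pos τ hw' j
  have h1 := chainSum_lt_iff τ hw
  have h2 := chainSum_lt_iff τ hw'
  simp only [chart, Real.exp_lt_exp]
  cases ε i <;> cases ε j <;>
    simp only [signOf, if_true, if_false, Bool.false_eq_true, one_mul, neg_one_mul, neg_lt_neg_iff,
      h1, h2]
  · exact iff_of_true (by linarith) (by linarith)
  · exact iff_of_false (by linarith) (by linarith)

/-- The arctangent of the `i`-th coordinate of a chart, in the coordinates `exp(-w)`. -/
def chartAngle (τ : Equiv.Perm (Fin n)) (ε : Fin n → Bool) (i : Fin n) (v : Fin n → ℝ) : ℝ :=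
  if ε i then Real.pi / 2 - Real.arctan (chainProd τ v i) else Real.arctan (chainProd τ v i)

theorem contDiff_chartAngle (τ : Equiv.Perm (Fin n)) (ε : Fin n → Bool) (i : Fin n) :
    ContDiff ℝ ∞ (chartAngle τ ε i) := by
  have := Real.contDiff_arctan.comp (contDiff_chainProd τ i)
  unfold chartAngle
  split_ifs
  · exact contDiff_const.sub this
  · exact this

/-- The identity `arctan (1/u) = π/2 - arctan u` for `u > 0` is what keeps the angle smooth in `v`
as `x_i` tends to infinity. -/
theorem arctan_chart (τ : Equiv.Perm (Fin n)) (ε : Fin n → Bool) (w : Fin n → ℝ) (i : Fin n) :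
    Real.arctan (chart τ ε w i) = chartAngle τ ε i (expNeg w) := by
  rw [chartAngle, chart, chainProd_expNeg, signOf]
  split_ifs
  · rw [← Real.arctan_inv_of_pos (Real.exp_pos _), Real.exp_neg, inv_inv, one_mul]
  · rw [neg_one_mul]

end Charts

/-! ### Smoothness in the charts and conclusion -/

section Final

variable {ι : Type*} [Fintype ι] [DecidableEq ι] {n : ℕ} {G : Subgroup (GL ι ℝ)}
  {E : Fin n → Matrix ι ι ℝ} {d : ℝ} {e : ℕ}

open scoped Matrix.Norms.Operator in
theorem contDiff_exp_sum_smul (B : Fin n → Matrix ι ι ℝ) (k l : ι) :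
    ContDiff ℝ ∞ fun θ : Fin n → ℝ => NormedSpace.exp (∑ j, θ j • B j) k l := by
  have h1 : ContDiff ℝ ∞ (NormedSpace.exp : Matrix ι ι ℝ → Matrix ι ι ℝ) :=
    contDiff_iff_contDiffAt.2 fun X => (NormedSpace.exp_analytic (𝕂 := ℝ) X).contDiffAt
  have h2 : ContDiff ℝ ∞ fun θ : Fin n → ℝ => ∑ j, θ j • B j :=
    ContDiff.sum fun j _ => (contDiff_apply ℝ ℝ j).smul contDiff_const
  exact (LinearMap.toContinuousLinearMap (Matrix.entryLinearMap ℝ ℝ k l)).contDiff.comp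
    (h1.comp h2)

theorem IsAdmissible.contDiff_apply_rotation (hG : IsAdmissible G E d e) {φ : maxCompact G → ℂ}
    (hφ : IsSmoothRightInvariant G E φ) :
    ContDiff ℝ ∞ fun θ : Fin n → ℝ => φ (hG.rotation θ) := by
  obtain ⟨⟨Φ, hΦ, hφΦ⟩, -⟩ := hφ
  simp only [hφΦ]
  exact hΦ.comp (contDiff_pi.2 fun k => contDiff_pi.2 fun l => contDiff_exp_sum_smul _ k l)

theorem IsAdmissible.exists_contDiff_chart (hG : IsAdmissible G E d e) {N : ℕ} (p : Fin N → Fin n)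
    (q : Fin n → Fin n) {φ : maxCompact G → ℂ} (hφ : IsSmoothRightInvariant G E φ)
    (τ : Equiv.Perm (Fin n)) (ε : Fin n → Bool) :
    ∃ ψ : (Fin n → ℝ) → ℂ, ContDiff ℝ ∞ ψ ∧ ∀ w ∈ orthant n,
      ((signProd (fun i => chart τ ε w (p i)) : ℝ) : ℂ) ^ (d : ℂ) *
        φ (kappaAt G E q (chart τ ε w)) = ψ (expNeg w) := by
  -- The order of the coordinates is constant on the chart, so the sign may be evaluated at the
  -- arbitrary point `w = (1, …, 1)`; only the angles depend on `v`.
  refine ⟨fun v => ((signProd (fun i => chart τ ε (fun _ => 1) (p i)) : ℝ) : ℂ) ^ (d : ℂ) *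
    φ (hG.rotation fun j => chartAngle τ ε (q j) v), contDiff_const.mul
    ((hG.contDiff_apply_rotation hφ).comp
      (contDiff_pi.2 fun j => contDiff_chartAngle τ ε (q j))), fun w hw => ?_⟩
  simp only [hG.apply_kappaAt_eq hφ, arctan_chart]
  rw [signProd_congr fun i j =>
    chart_lt_iff τ ε hw (w' := fun _ => 1) (fun _ => one_pos) (p i) (p j)]

theorem integrand_eq_radialWeight_mul (a : Fin n → ℕ) (b c : Fin n → ℝ) {N : ℕ}
    (p : Fin N → Fin n) (q : Fin n → Fin n) (φ : maxCompact G → ℂ) (z : ℂ × ℂ) :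
    integrand G E d (fun j => z.1 * a j + b j) (fun j => z.2 * a j + c j) p φ q = fun x =>
      radialWeight ((nilDim G E : ℝ) / n) a b c z x *
        (((signProd (fun i => x (p i)) : ℝ) : ℂ) ^ (d : ℂ) * φ (kappaAt G E q x)) := by
  funext x
  rw [integrand, radialWeight, mul_assoc]
  push_cast
  rfl

end Final

end RadialZeta

end

theorem mainTheorem4 {ι : Type*} [Fintype ι] [DecidableEq ι] {n : ℕ}
    (G : Subgroup (GL ι ℝ)) (E : Fin n → Matrix ι ι ℝ) (d : ℝ) (e : ℕ)
    (hG : RadialZeta.IsAdmissible G E d e)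
    (a : Fin n → ℕ) (ha : ∀ j, 0 < a j)
    (b c : Fin n → ℝ) (hb : ∀ j, 0 ≤ b j) (hc : ∀ j, 0 ≤ c j)
    (N : ℕ) (hN : 0 < N) (p : Fin N → Fin n) (hp : StrictMono p)
    (q : Fin n → Fin n)
    (φ : RadialZeta.maxCompact G → ℂ) (hφ : RadialZeta.IsSmoothRightInvariant G E φ) :
    (∀ z ∈ RadialZeta.domainD ((RadialZeta.nilDim G E : ℝ) / n) a b c,
      IntegrableOn
        (RadialZeta.integrand G E d (fun j => z.1 * a j + b j) (fun j => z.2 * a j + c j) p φ q)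
        (RadialZeta.orthant n)) ∧
    AnalyticOnNhd ℂ
      (fun z : ℂ × ℂ => RadialZeta.radialT G E d
        (fun j => z.1 * a j + b j) (fun j => z.2 * a j + c j) p φ q)
      (RadialZeta.domainD ((RadialZeta.nilDim G E : ℝ) / n) a b c) ∧
    ∃ T : ℂ × ℂ → ℂ, RadialZeta.IsMeromorphic T ∧
      ∀ z ∈ RadialZeta.domainD ((RadialZeta.nilDim G E : ℝ) / n) a b c,
        T z = RadialZeta.radialT G E d
          (fun j => z.1 * a j + b j) (fun j => z.2 * a j + c j) p φ q := by
  simp only [RadialZeta.radialT, RadialZeta.integrand_eq_radialWeight_mul]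
  exact RadialZeta.radial_continuation _ ha b c (hG.exists_contDiff_chart p q hφ)
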